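/- **Cirquents.** Formulas are built from literals ($p$ or $\neg p$, $p$ an atom) by the binary connectives $\wedge,\vee$. A *cirquent* is a formula in which each occurrence of a connective (each *oconnective*) carries an index $k^i$ of positive integers ($k$ names a *cluster*, $i$ its *rank*), such that any two oconnectives in the same cluster have the same type ($\wedge$ or $\vee$) and the same rank, and any two oconnectives of the same rank have the same type. Ranks are ordered by their labels; only their order matters, so the labels that occur need not be consecutive. A cluster is a *singleton* if exactly one oconnective belongs to it. A cirquent is *classical* if all its clusters are singletons; it is then identified with the formula obtained by deleting all indices. **Semantics.** An interpretation assigns $\top$ or $\bot$ to each atom and extends to literals as usual. Let $i_1<\dots<i_n$ be the ranks of the cirquent $C$. For functions $f_{i_t}:\{1,2,\dots\}\to\{\text{left},\text{right}\}$ ($1\le t\le n$), a literal is *metatrue* if it is true under the interpretation, and $A\odot_{k^i}B$ ($\odot\in\{\wedge,\vee\}$) is metatrue if $f_i(k)=\text{left}$ and $A$ is metatrue, or $f_i(k)=\text{right}$ and $B$ is metatrue. $C$ is *true* under the interpretation if $\mathcal Q_1f_{i_1}\cdots\mathcal Q_nf_{i_n}$ ($C$ is metatrue), where $\mathcal Q_t$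 is $\forall$ if the connectives of rank $i_t$ are conjunctions and $\exists$ if they are disjunctions. $C$ is *valid* if it is true under every interpretation. **The system $RIF_p$.** The axioms are the classical cirquents that, seen as formulas, are tautologies. In the rules below $\Phi\{\},\Psi\{\}$ are cirquents with one hole, $\odot,\circ\in\{\wedge,\vee\}$, and premise and conclusion must be cirquents. * Rule I: from $\Phi\{\Psi\{A\}\odot_{k^i}C\}$ infer $\Phi\{\Psi\{A\odot_{k^i}B\}\odot_{k^i}C\}$ (left); from $\Phi\{C\odot_{k^i}\Psi\{A\}\}$ infer $\Phi\{C\odot_{k^i}\Psi\{B\odot_{k^i}A\}\}$ (right). * Rule II: from $\Phi\{(A\circ_{m^j}C_1)\odot_{k^i}(B\circ_{n^j}C_2)\}$ infer $\Phi\{(A\odot_{k^i}B)\circ_{l^j}C\}$ (left); from $\Phi\{(C_1\circ_{m^j}A)\odot_{k^i}(C_2\circ_{n^j}B)\}$ infer $\Phi\{C\circ_{l^j}(A\odot_{k^i}B)\}$ (right). Conditions: (i) if $l$ is not a singleton in the conclusion then $m=n=l$, and if it is, then $m,n$ are singletons in the premise; (ii) $i\le j$; (iii) every rank $t$ occurring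 in $C$ satisfies $t\ge i$; (iv) each of $C_1,C_2$ results from $C$ by replacing each cluster ID that is a singleton in the conclusion by a cluster ID that is a singleton in the premise, ranks and all other cluster IDs being unchanged. * Rule III: from $\Phi\{(A\circ_{m^j}C)\odot_{k^i}(B\circ_{n^j}D)\}$ infer $\Phi\{(A\odot_{k^i}B)\circ_{l^j}(C\odot_{k^i}D)\}$, with conditions (i) and (ii) of Rule II. * Rule IV: from $\Phi\{A\odot_{k^i}B'\}$ infer $\Phi\{A\odot_{k^i}B\}$, where the index $l^j$ occurs in both $A$ and $B$, cluster $l$ occurs nowhere else in the conclusion, $B'$ results from $B$ by replacing all occurrences of $l^j$ by $r^j$, the cluster $r$ does not occur in the conclusion, and $i<j$. A *proof* of $C$ is a finite sequence of cirquents whose first member is an axiom, whose last member is $C$, and in which each later member follows from the one immediately before it by one of the rules. $C$ is *provable* if it has a proof. **Theorem.** A cirquent is valid if and only if it is provable in $RIF_p$. -/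

import Mathlib

namespace RIF

/-- The two binary connectives. -/
inductive Conn where
  | conj
  | disj

/-- The two possible choices made at a connective. -/
inductive Side where
  | left
  | right

/-- Literals over a set of atoms. -/
inductive Lit (α : Type*) where
  | pos (p : α)
  | neg (p : α)

/-- Truth of a literal under an interpretation `v` of the atoms. -/
def Lit.Holds {α : Type*} (v : α → Bool) : Lit α → Prop
  | .pos p => v p = true
  | .neg p => v p = false

/-! ### Classical formulas (in negation normal form) -/

inductive Formula (α : Type*) where
  | lit (L : Lit α)
  | bin (c : Conn) (A B : Formula α)

def Formula.Holds {α : Type*} (v : α → Bool) : Formula α → Prop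
  | .lit L => L.Holds v
  | .bin .conj A B => A.Holds v ∧ B.Holds v
  | .bin .disj A B => A.Holds v ∨ B.Holds v

def Formula.Tautology {α : Type*} (F : Formula α) : Prop :=
  ∀ v : α → Bool, F.Holds v

/-! ### Indexed formulas -/

/-- What is written at an occurrence of a connective: its type, the ID of its cluster, and the
rank of that cluster. -/
structure Oconn where
  conn : Conn
  cluster : ℕ+
  rank : ℕ+

/-- Formulas all of whose connectives carry an index: `bin c k i A B` is `A c_{k^i} B`. -/
inductive IForm (α : Type*) where
  | lit (L : Lit α)
  | bin (c : Conn) (k i : ℕ+) (A B : IForm α)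

namespace IForm

variable {α : Type*}

/-- All occurrences of connectives, one list entry for each occurrence. -/
def oconns : IForm α → List Oconn
  | lit _ => []
  | bin c k i A B => ⟨c, k, i⟩ :: (A.oconns ++ B.oconns)

/-- The cluster IDs, one list entry for each occurrence of a connective. -/
def clusters (T : IForm α) : List ℕ+ := T.oconns.map Oconn.cluster

/-- The set of the ranks that occur. -/
def ranks (T : IForm α) : Finset ℕ+ := (T.oconns.map Oconn.rank).toFinset

/-- Cluster `k` has exactly one element in `T`. -/
def IsSingleton (T : IForm α) (k : ℕ+) : Prop := T.clusters.count k = 1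

/-- Rank `i` contains a conjunctive cluster. -/
def IsConjRank (T : IForm α) (i : ℕ+) : Prop := ∃ o ∈ T.oconns, o.rank = i ∧ o.conn = .conj

/-- The underlying formula of classical logic. -/
def toFormula : IForm α → Formula α
  | lit L => .lit L
  | bin c _ _ A B => .bin c A.toFormula B.toFormula

/-- Replace every cluster ID `s` by `σ s`, keeping connectives and ranks. -/
def rename (σ : ℕ+ → ℕ+) : IForm α → IForm α
  | lit L => lit L
  | bin c k i A B => bin c (σ k) i (A.rename σ) (B.rename σ)

/-- Metatruth with respect to an interpretation `v` and a metaselection `f`, where `f i` is the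
`i`-metaselection: a connective with index `k^i` is resolved to the side `f i k`. -/
def Metatrue (v : α → Bool) (f : ℕ+ → ℕ+ → Side) : IForm α → Prop
  | lit L => L.Holds v
  | bin _ k i A B =>
    match f i k with
    | .left => A.Metatrue v f
    | .right => B.Metatrue v f

end IForm

open Classical in
/-- `Quantified conj is P f` is `Q₁g₁ … Qₙgₙ P(f with gₜ at rank iₜ)` where `is = [i₁, …, iₙ]` and
`Qₜ` is the universal quantifier if `conj iₜ` holds, the existential one otherwise. -/
def Quantified (conj : ℕ+ → Prop) :
    List ℕ+ → ((ℕ+ → ℕ+ → Side) → Prop) → (ℕ+ → ℕ+ → Side) → Prop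
  | [], P, f => P f
  | i :: is, P, f =>
    if conj i then ∀ g : ℕ+ → Side, Quantified conj is P (Function.update f i g)
    else ∃ g : ℕ+ → Side, Quantified conj is P (Function.update f i g)

/-! ### Cirquents -/

/-- A cirquent: clusters are the sets of occurrences with the same cluster ID, ranks are the sets
of clusters with the same rank label, and ranks are ordered by their labels. The labels that occur
need not be consecutive; only their order matters. -/
structure Cirquent (α : Type*) where
  tree : IForm α
  /-- A cluster consists of connectives of one type and belongs to one rank. -/
  cluster_ok : ∀ o ∈ tree.oconns, ∀ o' ∈ tree.oconns,
    o.cluster = o'.cluster → o.conn = o'.conn ∧ o.rank = o'.rank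
  /-- All clusters of a rank have the same type. -/
  rank_ok : ∀ o ∈ tree.oconns, ∀ o' ∈ tree.oconns, o.rank = o'.rank → o.conn = o'.conn

namespace Cirquent

variable {α : Type*}

/-- All clusters are singletons. -/
def IsClassical (C : Cirquent α) : Prop := ∀ k ∈ C.tree.clusters, C.tree.IsSingleton k

/-- Truth under an interpretation: the metaselections of the occurring ranks are quantified in
the order of the ranks. (The initial metaselection is immaterial: it is overwritten at every rank
that occurs.) -/
def IsTrue (C : Cirquent α) (v : α → Bool) : Prop :=
  Quantified C.tree.IsConjRank (C.tree.ranks.sort (· ≤ ·))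
    (fun f => C.tree.Metatrue v f) (fun _ _ => .left)

def Valid (C : Cirquent α) : Prop := ∀ v : α → Bool, C.IsTrue v

end Cirquent

/-! ### The calculus -/

/-- Indexed formulas with one hole. -/
inductive Ctx (α : Type*) where
  | hole
  | binL (c : Conn) (k i : ℕ+) (Φ : Ctx α) (B : IForm α)
  | binR (c : Conn) (k i : ℕ+) (A : IForm α) (Φ : Ctx α)

namespace Ctx

variable {α : Type*}

def fill : Ctx α → IForm α → IForm α
  | hole, T => T
  | binL c k i Φ B, T => .bin c k i (Φ.fill T) B
  | binR c k i A Φ, T => .bin c k i A (Φ.fill T)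

/-- The cluster IDs that occur outside the hole. -/
def clusters : Ctx α → List ℕ+
  | hole => []
  | binL _ k _ Φ B => k :: (Φ.clusters ++ B.clusters)
  | binR _ k _ A Φ => k :: (A.clusters ++ Φ.clusters)

end Ctx

/-- Side condition on a connective of cluster `l` of the conclusion `Q` that is split into two
connectives of clusters `m` and `n` of the premise `P`. -/
def SplitOK {α : Type*} (P Q : IForm α) (l m n : ℕ+) : Prop :=
  (¬ Q.IsSingleton l → m = l ∧ n = l) ∧
  (Q.IsSingleton l → P.IsSingleton m ∧ P.IsSingleton n)

/-- `C'` results from the part `C` of the conclusion `Q` by replacing each singleton cluster (of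
`Q`) by a singleton cluster (of the premise `P`) of the same rank; non-singleton clusters stay. -/
def IsCopy {α : Type*} (P Q C C' : IForm α) : Prop :=
  ∃ σ : ℕ+ → ℕ+, C' = C.rename σ ∧ ∀ s ∈ C.clusters,
    (Q.IsSingleton s → P.IsSingleton (σ s)) ∧ (¬ Q.IsSingleton s → σ s = s)

/-- `Rule P Q`: the conclusion `Q` follows from the premise `P` by one of the rules. -/
inductive Rule {α : Type*} (P Q : IForm α) : Prop where
  | I_left (Φ Ψ : Ctx α) (c : Conn) (k i : ℕ+) (A B C : IForm α)
      (hP : P = Φ.fill (.bin c k i (Ψ.fill A) C))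
      (hQ : Q = Φ.fill (.bin c k i (Ψ.fill (.bin c k i A B)) C))
  | I_right (Φ Ψ : Ctx α) (c : Conn) (k i : ℕ+) (A B C : IForm α)
      (hP : P = Φ.fill (.bin c k i C (Ψ.fill A)))
      (hQ : Q = Φ.fill (.bin c k i C (Ψ.fill (.bin c k i B A))))
  | II_left (Φ : Ctx α) (c d : Conn) (k i l m n j : ℕ+) (A B C C₁ C₂ : IForm α)
      (hP : P = Φ.fill (.bin c k i (.bin d m j A C₁) (.bin d n j B C₂)))
      (hQ : Q = Φ.fill (.bin d l j (.bin c k i A B) C))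
      (hsplit : SplitOK P Q l m n)
      (hij : i ≤ j)
      (hC : ∀ t ∈ C.ranks, i ≤ t)
      (hC₁ : IsCopy P Q C C₁)
      (hC₂ : IsCopy P Q C C₂)
  | II_right (Φ : Ctx α) (c d : Conn) (k i l m n j : ℕ+) (A B C C₁ C₂ : IForm α)
      (hP : P = Φ.fill (.bin c k i (.bin d m j C₁ A) (.bin d n j C₂ B)))
      (hQ : Q = Φ.fill (.bin d l j C (.bin c k i A B)))
      (hsplit : SplitOK P Q l m n)
      (hij : i ≤ j)
      (hC : ∀ t ∈ C.ranks, i ≤ t)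
      (hC₁ : IsCopy P Q C C₁)
      (hC₂ : IsCopy P Q C C₂)
  | III (Φ : Ctx α) (c d : Conn) (k i l m n j : ℕ+) (A B C D : IForm α)
      (hP : P = Φ.fill (.bin c k i (.bin d m j A C) (.bin d n j B D)))
      (hQ : Q = Φ.fill (.bin d l j (.bin c k i A B) (.bin c k i C D)))
      (hsplit : SplitOK P Q l m n)
      (hij : i ≤ j)
  | IV (Φ : Ctx α) (c : Conn) (k i l r j : ℕ+) (A B : IForm α)
      (hP : P = Φ.fill (.bin c k i A (B.rename (Function.update id l r))))
      (hQ : Q = Φ.fill (.bin c k i A B))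
      (hA : ∃ o ∈ A.oconns, o.cluster = l ∧ o.rank = j)
      (hB : ∃ o ∈ B.oconns, o.cluster = l ∧ o.rank = j)
      (hlk : l ≠ k)
      (hlΦ : l ∉ Φ.clusters)
      (hr : r ∉ Q.clusters)
      (hij : i < j)

namespace Cirquent

variable {α : Type*}

/-- Axioms: the classical cirquents that, seen as formulas, are tautologies. -/
def IsAxiom (C : Cirquent α) : Prop := C.IsClassical ∧ C.tree.toFormula.Tautology

/-- `pf` is a proof of `C`: a sequence of cirquents that starts with an axiom, ends with `C`, and
in which every later cirquent follows from the one before it by one of the rules. -/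
def IsProof (pf : List (Cirquent α)) (C : Cirquent α) : Prop :=
  (∃ A, pf.head? = some A ∧ A.IsAxiom) ∧
  pf.getLast? = some C ∧
  pf.IsChain (fun D E => Rule D.tree E.tree)

def Provable (C : Cirquent α) : Prop := ∃ pf : List (Cirquent α), IsProof pf C

end Cirquent

end RIF

namespace RIF

variable {α : Type*}

/-! ### Renaming, contexts and occurrences -/

/-- Renaming of the cluster ID of an occurrence of a connective. -/
def Oconn.rename (σ : ℕ+ → ℕ+) (o : Oconn) : Oconn := ⟨o.conn, σ o.cluster, o.rank⟩

@[simp] theorem Oconn.rename_conn (σ : ℕ+ → ℕ+) (o : Oconn) : (o.rename σ).conn = o.conn := rfl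
@[simp] theorem Oconn.rename_cluster (σ : ℕ+ → ℕ+) (o : Oconn) :
    (o.rename σ).cluster = σ o.cluster := rfl
@[simp] theorem Oconn.rename_rank (σ : ℕ+ → ℕ+) (o : Oconn) : (o.rename σ).rank = o.rank := rfl

namespace IForm

@[simp] theorem oconns_lit (L : Lit α) : (lit L).oconns = [] := rfl
@[simp] theorem oconns_bin (c : Conn) (k i : ℕ+) (A B : IForm α) :
    (bin c k i A B).oconns = ⟨c, k, i⟩ :: (A.oconns ++ B.oconns) := rfl

@[simp] theorem oconns_rename (σ : ℕ+ → ℕ+) (T : IForm α) :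
    (T.rename σ).oconns = T.oconns.map (Oconn.rename σ) := by
  induction T with
  | lit L => rfl
  | bin c k i A B hA hB => simp [rename, hA, hB, Oconn.rename]

@[simp] theorem clusters_lit (L : Lit α) : (lit L).clusters = [] := rfl
@[simp] theorem clusters_bin (c : Conn) (k i : ℕ+) (A B : IForm α) :
    (bin c k i A B).clusters = k :: (A.clusters ++ B.clusters) := by
  simp [clusters]

@[simp] theorem clusters_rename (σ : ℕ+ → ℕ+) (T : IForm α) :
    (T.rename σ).clusters = T.clusters.map σ := by
  simp [clusters, Function.comp_def]

theorem mem_clusters {T : IForm α} {x : ℕ+} : x ∈ T.clusters ↔ ∃ o ∈ T.oconns, o.cluster = x := by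
  simp [clusters]

theorem cluster_mem {T : IForm α} {o : Oconn} (h : o ∈ T.oconns) : o.cluster ∈ T.clusters :=
  mem_clusters.2 ⟨o, h, rfl⟩

theorem mem_ranks {T : IForm α} {r : ℕ+} : r ∈ T.ranks ↔ ∃ o ∈ T.oconns, o.rank = r := by
  simp [ranks]

theorem rename_eq_self {σ : ℕ+ → ℕ+} {T : IForm α} (h : ∀ x ∈ T.clusters, σ x = x) :
    T.rename σ = T := by
  induction T with
  | lit L => rfl
  | bin c k i A B hA hB =>
    simp only [clusters_bin, List.mem_cons, List.mem_append] at h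
    simp only [rename, hA (fun x hx => h x (.inr (.inl hx))), hB (fun x hx => h x (.inr (.inr hx))),
      h k (.inl rfl)]

theorem rename_congr {σ τ : ℕ+ → ℕ+} {T : IForm α} (h : ∀ x ∈ T.clusters, σ x = τ x) :
    T.rename σ = T.rename τ := by
  induction T with
  | lit L => rfl
  | bin c k i A B hA hB =>
    simp only [clusters_bin, List.mem_cons, List.mem_append] at h
    simp only [rename, hA (fun x hx => h x (.inr (.inl hx))), hB (fun x hx => h x (.inr (.inr hx))),
      h k (.inl rfl)]

theorem rename_rename (σ τ : ℕ+ → ℕ+) (T : IForm α) :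
    (T.rename σ).rename τ = T.rename (τ ∘ σ) := by
  induction T with
  | lit L => rfl
  | bin c k i A B hA hB => simp [rename, hA, hB]

end IForm

namespace Ctx

/-- The occurrences of connectives outside the hole. -/
def oconns : Ctx α → List Oconn
  | hole => []
  | binL c k i Φ B => ⟨c, k, i⟩ :: (Φ.oconns ++ B.oconns)
  | binR c k i A Φ => ⟨c, k, i⟩ :: (A.oconns ++ Φ.oconns)

theorem clusters_eq (Φ : Ctx α) : Φ.clusters = Φ.oconns.map Oconn.cluster := by
  induction Φ with
  | hole => rfl
  | binL c k i Φ B h => simp [clusters, oconns, h, IForm.clusters]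
  | binR c k i A Φ h => simp [clusters, oconns, h, IForm.clusters]

theorem mem_clusters {Φ : Ctx α} {x : ℕ+} : x ∈ Φ.clusters ↔ ∃ o ∈ Φ.oconns, o.cluster = x := by
  simp [clusters_eq]

theorem oconns_fill (Φ : Ctx α) (T : IForm α) :
    (Φ.fill T).oconns.Perm (Φ.oconns ++ T.oconns) := by
  induction Φ with
  | hole => simp [fill, oconns]
  | binL c k i Φ B h =>
    simp only [fill, oconns, IForm.oconns_bin, List.cons_append, List.perm_cons, List.append_assoc]
    refine (h.append_right _).trans ?_
    rw [List.append_assoc]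
    exact List.perm_append_comm.append_left _
  | binR c k i A Φ h =>
    simp only [fill, oconns, IForm.oconns_bin, List.cons_append, List.perm_cons, List.append_assoc]
    exact h.append_left _

theorem mem_oconns_fill {Φ : Ctx α} {T : IForm α} {o : Oconn} :
    o ∈ (Φ.fill T).oconns ↔ o ∈ Φ.oconns ∨ o ∈ T.oconns := by
  rw [(oconns_fill Φ T).mem_iff, List.mem_append]

theorem clusters_fill (Φ : Ctx α) (T : IForm α) :
    (Φ.fill T).clusters.Perm (Φ.clusters ++ T.clusters) := by
  rw [clusters_eq, IForm.clusters, IForm.clusters, ← List.map_append]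
  exact (oconns_fill Φ T).map _

theorem mem_clusters_fill {Φ : Ctx α} {T : IForm α} {x : ℕ+} :
    x ∈ (Φ.fill T).clusters ↔ x ∈ Φ.clusters ∨ x ∈ T.clusters := by
  rw [(clusters_fill Φ T).mem_iff, List.mem_append]

theorem count_fill (Φ : Ctx α) (T : IForm α) (x : ℕ+) :
    (Φ.fill T).clusters.count x = Φ.clusters.count x + T.clusters.count x := by
  rw [(clusters_fill Φ T).count_eq, List.count_append]

/-- Composition of contexts. -/
def comp : Ctx α → Ctx α → Ctx α
  | hole, Ψ => Ψ
  | binL c k i Φ B, Ψ => binL c k i (Φ.comp Ψ) B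
  | binR c k i A Φ, Ψ => binR c k i A (Φ.comp Ψ)

@[simp] theorem fill_comp (Φ Ψ : Ctx α) (T : IForm α) :
    (Φ.comp Ψ).fill T = Φ.fill (Ψ.fill T) := by
  induction Φ with
  | hole => rfl
  | binL c k i Φ B h => simp [comp, fill, h]
  | binR c k i A Φ h => simp [comp, fill, h]

theorem mem_clusters_comp {Φ Ψ : Ctx α} {x : ℕ+} :
    x ∈ (Φ.comp Ψ).clusters ↔ x ∈ Φ.clusters ∨ x ∈ Ψ.clusters := by
  induction Φ with
  | hole => simp [comp, clusters]
  | binL c k i Φ B h => simp [comp, clusters, h]; tauto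
  | binR c k i A Φ h => simp [comp, clusters, h]; tauto

end Ctx

/-! ### Metatruth -/

theorem IForm.metatrue_rename {v : α → Bool} {σ : ℕ+ → ℕ+} {f g : ℕ+ → ℕ+ → Side} {T : IForm α}
    (h : ∀ o ∈ T.oconns, g o.rank o.cluster = f o.rank (σ o.cluster)) :
    (T.rename σ).Metatrue v f ↔ T.Metatrue v g := by
  induction T with
  | lit L => rfl
  | bin c k i A B hA hB =>
    simp only [IForm.oconns_bin, List.mem_cons, List.mem_append] at h
    have hk := h ⟨c, k, i⟩ (.inl rfl)
    simp only [IForm.rename, IForm.Metatrue]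
    simp only at hk
    rw [← hk]
    cases g i k
    · exact hA fun o ho => h o (.inr (.inl ho))
    · exact hB fun o ho => h o (.inr (.inr ho))

theorem IForm.metatrue_congr {v : α → Bool} {f g : ℕ+ → ℕ+ → Side} {T : IForm α}
    (h : ∀ o ∈ T.oconns, g o.rank o.cluster = f o.rank o.cluster) :
    T.Metatrue v f ↔ T.Metatrue v g := by
  have := IForm.metatrue_rename (v := v) (σ := id) h
  rwa [IForm.rename_eq_self (σ := id) (fun _ _ => rfl)] at this

theorem Ctx.metatrue_fill_congr {v : α → Bool} {f g : ℕ+ → ℕ+ → Side} {Φ : Ctx α} {S T : IForm α}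
    (h : ∀ o ∈ Φ.oconns, g o.rank o.cluster = f o.rank o.cluster)
    (hST : S.Metatrue v f ↔ T.Metatrue v g) :
    (Φ.fill S).Metatrue v f ↔ (Φ.fill T).Metatrue v g := by
  induction Φ with
  | hole => exact hST
  | binL c k i Φ B hΦ =>
    simp only [Ctx.oconns, List.mem_cons, List.mem_append] at h
    have hk := h ⟨c, k, i⟩ (.inl rfl)
    simp only at hk
    simp only [Ctx.fill, IForm.Metatrue]
    rw [hk]
    cases f i k
    · exact hΦ fun o ho => h o (.inr (.inl ho))
    · exact IForm.metatrue_congr fun o ho => h o (.inr (.inr ho))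
  | binR c k i A Φ hΦ =>
    simp only [Ctx.oconns, List.mem_cons, List.mem_append] at h
    have hk := h ⟨c, k, i⟩ (.inl rfl)
    simp only at hk
    simp only [Ctx.fill, IForm.Metatrue]
    rw [hk]
    cases f i k
    · exact IForm.metatrue_congr fun o ho => h o (.inr (.inl ho))
    · exact hΦ fun o ho => h o (.inr (.inr ho))

/-! ### Quantified metaselections -/

instance : Nonempty Side := ⟨.left⟩

theorem quantified_congr_conj {conj conj' : ℕ+ → Prop} {φ : (ℕ+ → ℕ+ → Side) → Prop} {L : List ℕ+}
    (h : ∀ i ∈ L, conj i ↔ conj' i) (f : ℕ+ → ℕ+ → Side) :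
    Quantified conj L φ f ↔ Quantified conj' L φ f := by
  induction L generalizing f with
  | nil => rfl
  | cons i L ih =>
    simp only [List.mem_cons, forall_eq_or_imp] at h
    simp only [Quantified, ih h.2]
    by_cases hc : conj' i <;> simp [h.1, hc]

theorem quantified_filter {conj : ℕ+ → Prop} {φ : (ℕ+ → ℕ+ → Side) → Prop} (S : Finset ℕ+)
    (hφ : ∀ f f', (∀ r ∈ S, f r = f' r) → (φ f ↔ φ f')) (L : List ℕ+) :
    ∀ f f', (∀ r ∈ S, r ∉ L → f r = f' r) →
      (Quantified conj L φ f ↔ Quantified conj (L.filter (· ∈ S)) φ f') := by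
  induction L with
  | nil => exact fun f f' h => hφ f f' fun r hr => h r hr (by simp)
  | cons i L ih =>
    intro f f' h
    by_cases hi : i ∈ S
    · have key : ∀ g, Quantified conj L φ (Function.update f i g) ↔
          Quantified conj (L.filter (· ∈ S)) φ (Function.update f' i g) := by
        intro g
        refine ih _ _ fun r hr hrL => ?_
        by_cases hri : r = i
        · subst hri; simp
        · rw [Function.update_of_ne hri, Function.update_of_ne hri]
          exact h r hr (by simp [hri, hrL])
      rw [List.filter_cons_of_pos (by simpa using hi)]
      simp only [Quantified, key]
    · have key : ∀ g, Quantified conj L φ (Function.update f i g) ↔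
          Quantified conj (L.filter (· ∈ S)) φ f' := by
        intro g
        refine ih _ _ fun r hr hrL => ?_
        have hri : r ≠ i := fun e => hi (e ▸ hr)
        rw [Function.update_of_ne hri]
        exact h r hr (by simp [hri, hrL])
      rw [List.filter_cons_of_neg (by simpa using hi)]
      simp only [Quantified, key]
      split_ifs <;> simp

/-- Back-and-forth argument for quantified metaselections. -/
theorem quantified_bisim {conj : ℕ+ → Prop} {φ ψ : (ℕ+ → ℕ+ → Side) → Prop}
    (R : ℕ+ → (ℕ+ → ℕ+ → Side) → (ℕ+ → ℕ+ → Side) → Prop)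
    (hloc : ∀ r f f' g g', (∀ t ≤ r, f t = f' t) → (∀ t ≤ r, g t = g' t) → R r f g → R r f' g')
    (forth : ∀ r f g a, ∃ b, R r (Function.update f r a) (Function.update g r b))
    (back : ∀ r f g b, ∃ a, R r (Function.update f r a) (Function.update g r b))
    (L : List ℕ+) (hL : L.Pairwise (· < ·)) :
    ∀ (D : Set ℕ+) (f g : ℕ+ → ℕ+ → Side), (∀ d ∈ D, ∀ r ∈ L, d < r) → (∀ d ∈ D, R d f g) →
      (∀ f g, (∀ d ∈ D, R d f g) → (∀ r ∈ L, R r f g) → (φ f ↔ ψ g)) →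
      (Quantified conj L φ f ↔ Quantified conj L ψ g) := by
  induction L with
  | nil => exact fun D f g _ hR hfin => hfin f g hR (by simp)
  | cons i L ih =>
    intro D f g hD hR hfin
    rw [List.pairwise_cons] at hL
    have key : ∀ a b, R i (Function.update f i a) (Function.update g i b) →
        (Quantified conj L φ (Function.update f i a) ↔
          Quantified conj L ψ (Function.update g i b)) := by
      intro a b hab
      refine ih hL.2 (insert i D) _ _ ?_ ?_ ?_
      · rintro d (rfl | hd) r hr
        · exact hL.1 r hr
        · exact hD d hd r (by simp [hr])
      · rintro d (rfl | hd)
        · exact hab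
        · have hdi := hD d hd i (by simp)
          refine hloc d f _ g _ (fun t ht => ?_) (fun t ht => ?_) (hR d hd) <;>
            rw [Function.update_of_ne (ht.trans_lt hdi).ne]
      · intro f' g' h1 h2
        refine hfin f' g' (fun d hd => h1 d (.inr hd)) ?_
        simp only [List.mem_cons, forall_eq_or_imp]
        exact ⟨h1 i (.inl rfl), h2⟩
    simp only [Quantified]
    split_ifs
    · constructor
      · intro h b
        obtain ⟨a, ha⟩ := back i f g b
        exact (key a b ha).1 (h a)
      · intro h a
        obtain ⟨b, hb⟩ := forth i f g a
        exact (key a b hb).2 (h b)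
    · constructor
      · rintro ⟨a, h⟩
        obtain ⟨b, hb⟩ := forth i f g a
        exact ⟨b, (key a b hb).1 h⟩
      · rintro ⟨b, h⟩
        obtain ⟨a, ha⟩ := back i f g b
        exact ⟨a, (key a b ha).2 h⟩

/-- Truth of an indexed formula under an interpretation. -/
def IForm.TrueAt (T : IForm α) (v : α → Bool) : Prop :=
  Quantified T.IsConjRank (T.ranks.sort (· ≤ ·)) (fun f => T.Metatrue v f) (fun _ _ => .left)

theorem filter_sort_of_subset {S R : Finset ℕ+} (h : S ⊆ R) :
    (R.sort (· ≤ ·)).filter (· ∈ S) = S.sort (· ≤ ·) := by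
  refine List.Perm.eq_of_pairwise (le := (· ≤ ·)) (fun a b _ _ => le_antisymm)
    ((Finset.pairwise_sort R _).filter _) (Finset.pairwise_sort S _) ?_
  rw [List.perm_ext_iff_of_nodup ((Finset.sort_nodup R _).filter _) (Finset.sort_nodup S _)]
  intro a
  simp only [List.mem_filter, Finset.mem_sort, decide_eq_true_eq]
  exact ⟨fun h => h.2, fun ha => ⟨h ha, ha⟩⟩

theorem IForm.trueAt_iff_quantified {T : IForm α} {v : α → Bool} {R : Finset ℕ+}
    {conj : ℕ+ → Prop} (hR : T.ranks ⊆ R) (hconj : ∀ r ∈ T.ranks, T.IsConjRank r ↔ conj r) :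
    T.TrueAt v ↔ Quantified conj (R.sort (· ≤ ·)) (fun f => T.Metatrue v f) (fun _ _ => .left) := by
  rw [quantified_filter T.ranks _ _ _ (fun _ _ => .left) (fun _ _ _ => rfl),
    filter_sort_of_subset hR]
  · exact quantified_congr_conj (fun r hr => hconj r (by simpa using hr)) _
  · intro f f' h
    refine IForm.metatrue_congr fun o ho => ?_
    rw [h o.rank (IForm.mem_ranks.2 ⟨o, ho, rfl⟩)]

/-- The well-formedness condition on cirquents. -/
structure IForm.Wf (T : IForm α) : Prop where
  cluster_ok : ∀ o ∈ T.oconns, ∀ o' ∈ T.oconns,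
    o.cluster = o'.cluster → o.conn = o'.conn ∧ o.rank = o'.rank
  rank_ok : ∀ o ∈ T.oconns, ∀ o' ∈ T.oconns, o.rank = o'.rank → o.conn = o'.conn

/-- Two indexed formulas are equally true if the metaselections of one arise from those of the
other by a renaming that depends on the side chosen at one cluster `k` of rank `i`. -/
theorem trueAt_iff_of_renaming {P Q : IForm α} {v : α → Bool} {k i : ℕ+} {τ : Side → ℕ+ → ℕ+}
    (hQ : Q.Wf)
    (hPQ : ∀ o ∈ P.oconns, ∃ o' ∈ Q.oconns, o'.conn = o.conn ∧ o'.rank = o.rank)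
    (hτk : ∀ s, τ s k = k)
    (hlow : ∀ s, ∀ o ∈ Q.oconns, o.rank < i → τ s o.cluster = o.cluster)
    (hinj : ∀ s, Set.InjOn (τ s) {x | x ∈ Q.clusters}) (hk : k ∈ Q.clusters)
    (hmeta : ∀ f g, (∀ o ∈ Q.oconns, g o.rank o.cluster = f o.rank (τ (f i k) o.cluster)) →
      (P.Metatrue v f ↔ Q.Metatrue v g)) :
    P.TrueAt v ↔ Q.TrueAt v := by
  have hsub : P.ranks ⊆ Q.ranks := by
    intro r hr
    obtain ⟨o, ho, rfl⟩ := IForm.mem_ranks.1 hr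
    obtain ⟨o', ho', -, h⟩ := hPQ o ho
    exact IForm.mem_ranks.2 ⟨o', ho', h⟩
  have hconj : ∀ r ∈ P.ranks, P.IsConjRank r ↔ Q.IsConjRank r := by
    intro r hr
    obtain ⟨p, hp, rfl⟩ := IForm.mem_ranks.1 hr
    obtain ⟨p', hp', hpc, hpr⟩ := hPQ p hp
    constructor
    · rintro ⟨o, ho, hor, hoc⟩
      obtain ⟨o', ho', h1, h2⟩ := hPQ o ho
      exact ⟨o', ho', h2.trans hor, h1.trans hoc⟩
    · rintro ⟨o, ho, hor, hoc⟩
      exact ⟨p, hp, rfl, by rw [← hpc, ← hoc]; exact hQ.rank_ok p' hp' o ho (hpr.trans hor.symm)⟩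
  rw [IForm.trueAt_iff_quantified hsub hconj, IForm.TrueAt]
  let R : ℕ+ → (ℕ+ → ℕ+ → Side) → (ℕ+ → ℕ+ → Side) → Prop := fun r f g =>
    ∀ o ∈ Q.oconns, o.rank = r →
      g r o.cluster = f r (if i ≤ r then τ (f i k) o.cluster else o.cluster)
  refine quantified_bisim R ?_ ?_ ?_ _ (Finset.sortedLT_sort _).pairwise ∅ _ _ (by simp) (by simp)
    ?_
  · intro r f f' g g' hf hg hR o ho hor
    have := hR o ho hor
    rw [← hf r le_rfl, ← hg r le_rfl, this]
    by_cases hir : i ≤ r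
    · rw [hf i hir]
    · simp [hir]
  · intro r f g a
    refine ⟨fun x => a (if i ≤ r then τ (Function.update f r a i k) x else x), ?_⟩
    intro o ho hor
    simp only [Function.update_self]
  · intro r f g b
    by_cases hir : i ≤ r
    · let s : Side := if r = i then b k else f i k
      have hs : ∀ x ∈ Q.clusters, Function.invFunOn (τ s) {x | x ∈ Q.clusters} (τ s x) = x :=
        fun x hx => (hinj s).leftInvOn_invFunOn hx
      refine ⟨fun x => b (Function.invFunOn (τ s) {x | x ∈ Q.clusters} x), ?_⟩
      intro o ho hor
      have hside : Function.update f r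
          (fun x => b (Function.invFunOn (τ s) {x | x ∈ Q.clusters} x)) i k = s := by
        by_cases hri : r = i
        · subst hri
          have := hs k hk
          rw [hτk] at this
          simp only [Function.update_self, this]
          simp [s]
        · rw [Function.update_of_ne (Ne.symm hri)]
          simp [s, hri]
      rw [hside]
      simp only [Function.update_self, hir, if_true]
      rw [hs _ (IForm.cluster_mem ho)]
    · exact ⟨b, fun o ho hor => by simp [hir]⟩
  · intro f g _ h
    refine hmeta f g fun o ho => ?_
    rw [h o.rank (by simpa using IForm.mem_ranks.2 ⟨o, ho, rfl⟩) o ho rfl]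
    by_cases hir : i ≤ o.rank
    · simp [hir]
    · simp only [hir, if_false]
      rw [hlow _ o ho (not_le.1 hir)]

/-! ### The rules preserve truth in both directions -/

theorem injOn_of_count_le {τ : ℕ+ → ℕ+} {M N : List ℕ+} {S : Set ℕ+} (hS : ∀ x ∈ S, x ∈ M)
    (hcount : ∀ x, (M.map τ).count x ≤ N.count x)
    (hτ : ∀ x ∈ S, τ x ≠ x → N.count (τ x) = 1) : Set.InjOn τ S := by
  intro x hx y hy hxy
  by_contra hne
  have h2 : 2 ≤ N.count (τ x) := by
    have hsub : [x, y].Subperm M := by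
      refine List.subperm_of_subset (by simp [hne]) ?_
      intro z hz
      simp only [List.mem_cons, List.not_mem_nil, or_false] at hz
      rcases hz with rfl | rfl
      exacts [hS _ hx, hS _ hy]
    obtain ⟨M', hperm, hsub⟩ := hsub
    have h1 := (hsub.map τ).count_le (τ x)
    rw [(hperm.map τ).count_eq] at h1
    have h3 := hcount (τ x)
    simp [← hxy] at h1
    omega
  have hx' : τ x = x := by
    by_contra h
    have := hτ x hx h
    omega
  have hy' : τ y = y := by
    by_contra h
    have := hτ y hy h
    rw [← hxy] at this
    omega
  exact hne (by rw [← hx', ← hy', hxy])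

theorem trueAt_iff_of_duplication {P Q : IForm α} {v : α → Bool} {k i l m n : ℕ+}
    {U D E : List ℕ+} {σ₁ σ₂ : ℕ+ → ℕ+} (hQ : Q.Wf)
    (hPQ : ∀ o ∈ P.oconns, ∃ o' ∈ Q.oconns, o'.conn = o.conn ∧ o'.rank = o.rank)
    (hQU : Q.clusters.Perm (U ++ (l :: D) ++ E)) (hE : ∀ x ∈ E, x ∈ U)
    (hPU : P.clusters.Perm (U ++ ((m :: D.map σ₁) ++ (n :: D.map σ₂)))) (hkU : k ∈ U)
    (hsplit : SplitOK P Q l m n)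
    (hσ₁ : ∀ s ∈ D, (Q.IsSingleton s → P.IsSingleton (σ₁ s)) ∧ (¬ Q.IsSingleton s → σ₁ s = s))
    (hσ₂ : ∀ s ∈ D, (Q.IsSingleton s → P.IsSingleton (σ₂ s)) ∧ (¬ Q.IsSingleton s → σ₂ s = s))
    (hrank : ∀ o ∈ Q.oconns, o.cluster ∈ l :: D → i ≤ o.rank)
    (hmeta : ∀ (f g : ℕ+ → ℕ+ → Side) (τ : ℕ+ → ℕ+), (∀ x ∈ U, τ x = x) →
      (f i k = .left → τ l = m ∧ ∀ x ∈ D, τ x = σ₁ x) →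
      (f i k = .right → τ l = n ∧ ∀ x ∈ D, τ x = σ₂ x) →
      (∀ o ∈ Q.oconns, g o.rank o.cluster = f o.rank (τ o.cluster)) →
      (P.Metatrue v f ↔ Q.Metatrue v g)) :
    P.TrueAt v ↔ Q.TrueAt v := by
  classical
  let σ : Side → ℕ+ → ℕ+ := fun s => match s with | .left => σ₁ | .right => σ₂
  let p : Side → ℕ+ := fun s => match s with | .left => m | .right => n
  let τ : Side → ℕ+ → ℕ+ := fun s x => if x ∈ D then σ s x else if x = l then p s else x
  have hσ : ∀ s, ∀ x ∈ D, (Q.IsSingleton x → P.IsSingleton (σ s x)) ∧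
      (¬ Q.IsSingleton x → σ s x = x) := by
    rintro (_ | _); exacts [hσ₁, hσ₂]
  have hp : ∀ s, (Q.IsSingleton l → P.IsSingleton (p s)) ∧ (¬ Q.IsSingleton l → p s = l) := by
    rintro (_ | _)
    · exact ⟨fun h => (hsplit.2 h).1, fun h => (hsplit.1 h).1⟩
    · exact ⟨fun h => (hsplit.2 h).2, fun h => (hsplit.1 h).2⟩
  have hcountQ : ∀ x, Q.clusters.count x = U.count x + (l :: D).count x + E.count x := by
    intro x; rw [hQU.count_eq, List.count_append, List.count_append]
  have hτl : ∀ s, τ s l = p s := by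
    intro s
    by_cases h : l ∈ D
    · have hns : ¬ Q.IsSingleton l := by
        have h1 := hcountQ l
        have h2 : 0 < D.count l := List.count_pos_iff.2 h
        rw [List.count_cons_self] at h1
        unfold IForm.IsSingleton; omega
      simp only [τ, h, if_true, (hσ s l h).2 hns, (hp s).2 hns]
    · simp [τ, h]
  have hτD : ∀ s, ∀ x ∈ D, τ s x = σ s x := fun s x hx => by simp [τ, hx]
  have hτU : ∀ s, ∀ x ∈ U, τ s x = x := by
    intro s x hx
    have hns : x ∈ l :: D → ¬ Q.IsSingleton x := by
      intro h
      have h1 := hcountQ x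
      have h2 := List.count_pos_iff.2 h
      have h3 := List.count_pos_iff.2 hx
      unfold IForm.IsSingleton; omega
    by_cases hxD : x ∈ D
    · rw [hτD s x hxD, (hσ s x hxD).2 (hns (by simp [hxD]))]
    · by_cases hxl : x = l
      · subst hxl
        rw [hτl, (hp s).2 (hns (by simp))]
      · simp [τ, hxD, hxl]
  have hmemQ : ∀ x ∈ Q.clusters, x ∈ U ++ (l :: D) := by
    intro x hx
    rw [hQU.mem_iff, List.mem_append] at hx
    rcases hx with hx | hx
    exacts [hx, List.mem_append_left _ (hE x hx)]
  refine trueAt_iff_of_renaming (k := k) (i := i) (τ := τ) hQ hPQ (fun s => hτU s k hkU) ?_ ?_ ?_ ?_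
  · intro s o ho hoi
    have : o.cluster ∉ l :: D := fun h => (hrank o ho h).not_gt hoi
    simp only [List.mem_cons, not_or] at this
    simp [τ, this]
  · intro s
    refine injOn_of_count_le (M := U ++ (l :: D)) (N := P.clusters) hmemQ ?_ ?_
    · intro x
      have e1 : U.map (τ s) = U := by
        conv_rhs => rw [← List.map_id U]
        exact List.map_congr_left (hτU s)
      have e2 : D.map (τ s) = D.map (σ s) := List.map_congr_left (hτD s)
      rw [hPU.count_eq, List.map_append, e1, List.map_cons, e2, hτl]
      cases s <;> simp only [List.count_append, σ, p] <;> omega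
    · intro x hx hne
      rcases List.mem_append.1 (hmemQ x hx) with h | h
      · exact absurd (hτU s x h) hne
      · rcases List.mem_cons.1 h with rfl | h
        · rw [hτl] at hne ⊢
          exact (hp s).1 (by by_contra h; exact hne ((hp s).2 h))
        · rw [hτD s x h] at hne ⊢
          exact (hσ s x h).1 (by by_contra h'; exact hne ((hσ s x h).2 h'))
  · exact (hQU.mem_iff).2 (by simp [hkU])
  · intro f g h
    refine hmeta f g (τ (f i k)) (hτU _) ?_ ?_ h
    · intro hf; rw [hf]; exact ⟨hτl .left, hτD .left⟩
    · intro hf; rw [hf]; exact ⟨hτl .right, hτD .right⟩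

theorem perm_of_count {L M : List ℕ+} (h : ∀ x, L.count x = M.count x) : L.Perm M :=
  List.perm_iff_count.2 h

theorem Ctx.exists_oconn_fill {Φ : Ctx α} {S T : IForm α}
    (h : ∀ o ∈ S.oconns, ∃ o' ∈ T.oconns, o'.conn = o.conn ∧ o'.rank = o.rank) :
    ∀ o ∈ (Φ.fill S).oconns, ∃ o' ∈ (Φ.fill T).oconns, o'.conn = o.conn ∧ o'.rank = o.rank := by
  intro o ho
  rcases Ctx.mem_oconns_fill.1 ho with ho | ho
  · exact ⟨o, Ctx.mem_oconns_fill.2 (.inl ho), rfl, rfl⟩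
  · obtain ⟨o', ho', h'⟩ := h o ho
    exact ⟨o', Ctx.mem_oconns_fill.2 (.inr ho'), h'⟩

theorem trueAt_iff_of_agree {P Q : IForm α} {v : α → Bool} {k : ℕ+} (hQ : Q.Wf)
    (hk : k ∈ Q.clusters)
    (hPQ : ∀ o ∈ P.oconns, ∃ o' ∈ Q.oconns, o'.conn = o.conn ∧ o'.rank = o.rank)
    (hmeta : ∀ f g, (∀ o ∈ Q.oconns, g o.rank o.cluster = f o.rank o.cluster) →
      (P.Metatrue v f ↔ Q.Metatrue v g)) :
    P.TrueAt v ↔ Q.TrueAt v :=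
  trueAt_iff_of_renaming (k := k) (i := 1) (τ := fun _ => id) hQ hPQ (fun _ => rfl)
    (fun _ _ _ _ => rfl) (fun _ => Set.injOn_id _) hk hmeta

theorem trueAt_iff_of_rule {P Q : IForm α} {v : α → Bool} (hQ : Q.Wf) (h : Rule P Q) :
    P.TrueAt v ↔ Q.TrueAt v := by
  cases h with
  | I_left Φ Ψ c k i A B C hP hQ' =>
    subst hP hQ'
    refine trueAt_iff_of_agree (k := k) hQ ?_ ?_ ?_
    · simp [Ctx.mem_clusters_fill]
    · refine Ctx.exists_oconn_fill fun o ho => ⟨o, ?_, rfl, rfl⟩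
      simp only [IForm.oconns_bin, List.mem_cons, List.mem_append, Ctx.mem_oconns_fill] at ho ⊢
      tauto
    · intro f g h
      simp only [IForm.oconns_bin, List.mem_cons, List.mem_append, Ctx.mem_oconns_fill] at h
      refine Ctx.metatrue_fill_congr (fun o ho => h o (.inl ho)) ?_
      have hk := h ⟨c, k, i⟩ (.inr (.inl rfl))
      simp only at hk
      cases hf : f i k
      · simp only [IForm.Metatrue, hk, hf]
        refine Ctx.metatrue_fill_congr (fun o ho => h o (by tauto)) ?_
        simp only [IForm.Metatrue, hk, hf]
        exact IForm.metatrue_congr fun o ho => h o (by tauto)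
      · simp only [IForm.Metatrue, hk, hf]
        exact IForm.metatrue_congr fun o ho => h o (by tauto)
  | I_right Φ Ψ c k i A B C hP hQ' =>
    subst hP hQ'
    refine trueAt_iff_of_agree (k := k) hQ ?_ ?_ ?_
    · simp [Ctx.mem_clusters_fill]
    · refine Ctx.exists_oconn_fill fun o ho => ⟨o, ?_, rfl, rfl⟩
      simp only [IForm.oconns_bin, List.mem_cons, List.mem_append, Ctx.mem_oconns_fill] at ho ⊢
      tauto
    · intro f g h
      simp only [IForm.oconns_bin, List.mem_cons, List.mem_append, Ctx.mem_oconns_fill] at h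
      refine Ctx.metatrue_fill_congr (fun o ho => h o (.inl ho)) ?_
      have hk := h ⟨c, k, i⟩ (.inr (.inl rfl))
      simp only at hk
      cases hf : f i k
      · simp only [IForm.Metatrue, hk, hf]
        exact IForm.metatrue_congr fun o ho => h o (by tauto)
      · simp only [IForm.Metatrue, hk, hf]
        refine Ctx.metatrue_fill_congr (fun o ho => h o (by tauto)) ?_
        simp only [IForm.Metatrue, hk, hf]
        exact IForm.metatrue_congr fun o ho => h o (by tauto)
  | II_left Φ c d k i l m n j A B C C₁ C₂ hP hQ' hsplit hij hC hC₁ hC₂ =>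
    obtain ⟨σ₁, rfl, hσ₁⟩ := hC₁
    obtain ⟨σ₂, rfl, hσ₂⟩ := hC₂
    subst hP hQ'
    have hmem : ∀ o, o ∈ Φ.oconns ∨ o = ⟨d, l, j⟩ ∨ o = ⟨c, k, i⟩ ∨ o ∈ A.oconns ∨ o ∈ B.oconns ∨
        o ∈ C.oconns → o ∈ (Φ.fill (.bin d l j (.bin c k i A B) C)).oconns := by
      intro o
      simp only [IForm.oconns_bin, List.mem_cons, List.mem_append, Ctx.mem_oconns_fill]
      tauto
    refine trueAt_iff_of_duplication (k := k) (i := i) (D := C.clusters) (E := [])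
      (U := Φ.clusters ++ (k :: (A.clusters ++ B.clusters))) hQ ?_ ?_ (by simp) ?_ (by simp) hsplit
      hσ₁ hσ₂ ?_ ?_
    · refine Ctx.exists_oconn_fill fun o ho => ?_
      simp only [IForm.oconns_bin, List.mem_cons, List.mem_append, IForm.oconns_rename,
        List.mem_map] at ho
      rcases ho with rfl | (rfl | ho | ⟨o, ho, rfl⟩) | rfl | ho | ⟨o, ho, rfl⟩
      · exact ⟨⟨c, k, i⟩, by simp, rfl, rfl⟩
      · exact ⟨⟨d, l, j⟩, by simp, rfl, rfl⟩
      · exact ⟨o, by simp [ho], rfl, rfl⟩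
      · exact ⟨o, by simp [ho], rfl, rfl⟩
      · exact ⟨⟨d, l, j⟩, by simp, rfl, rfl⟩
      · exact ⟨o, by simp [ho], rfl, rfl⟩
      · exact ⟨o, by simp [ho], rfl, rfl⟩
    · refine perm_of_count fun x => ?_
      simp only [Ctx.count_fill, IForm.clusters_bin, List.count_append, List.count_cons,
        List.count_nil]
      omega
    · refine perm_of_count fun x => ?_
      simp only [Ctx.count_fill, IForm.clusters_bin, List.count_append, List.count_cons,
        IForm.clusters_rename]
      omega
    · intro o ho hol
      rcases List.mem_cons.1 hol with hol | hol
      · exact hij.trans (hQ.cluster_ok ⟨d, l, j⟩ (hmem _ (by tauto)) o ho hol.symm).2.le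
      · obtain ⟨o', ho', he⟩ := IForm.mem_clusters.1 hol
        exact (hC _ (IForm.mem_ranks.2 ⟨o', ho', rfl⟩)).trans
          (hQ.cluster_ok o' (hmem _ (by tauto)) o ho he).2.le
    · intro f g τ hU hl hr h
      have hfix : ∀ o, (o ∈ Φ.oconns ∨ o = ⟨c, k, i⟩ ∨ o ∈ A.oconns ∨ o ∈ B.oconns) →
          g o.rank o.cluster = f o.rank o.cluster := by
        intro o ho
        rw [h o (hmem o (by tauto)), hU]
        simp only [List.mem_append, List.mem_cons, Ctx.mem_clusters]
        rcases ho with ho | rfl | ho | ho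
        · exact .inl ⟨o, ho, rfl⟩
        · simp
        · simp [IForm.cluster_mem ho]
        · simp [IForm.cluster_mem ho]
      refine Ctx.metatrue_fill_congr (fun o ho => hfix o (by tauto)) ?_
      have hk := hfix ⟨c, k, i⟩ (by tauto)
      have hgl := h ⟨d, l, j⟩ (hmem _ (by tauto))
      simp only at hk hgl
      simp only [IForm.Metatrue, hk, hgl]
      cases hf : f i k
      · rw [(hl hf).1]
        cases f j m
        · exact IForm.metatrue_congr fun o ho => hfix o (by tauto)
        · refine IForm.metatrue_rename fun o ho => ?_
          rw [h o (hmem o (by tauto)), (hl hf).2 _ (IForm.cluster_mem ho)]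
      · rw [(hr hf).1]
        cases f j n
        · exact IForm.metatrue_congr fun o ho => hfix o (by tauto)
        · refine IForm.metatrue_rename fun o ho => ?_
          rw [h o (hmem o (by tauto)), (hr hf).2 _ (IForm.cluster_mem ho)]
  | II_right Φ c d k i l m n j A B C C₁ C₂ hP hQ' hsplit hij hC hC₁ hC₂ =>
    obtain ⟨σ₁, rfl, hσ₁⟩ := hC₁
    obtain ⟨σ₂, rfl, hσ₂⟩ := hC₂
    subst hP hQ'
    have hmem : ∀ o, o ∈ Φ.oconns ∨ o = ⟨d, l, j⟩ ∨ o = ⟨c, k, i⟩ ∨ o ∈ A.oconns ∨ o ∈ B.oconns ∨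
        o ∈ C.oconns → o ∈ (Φ.fill (.bin d l j C (.bin c k i A B))).oconns := by
      intro o
      simp only [IForm.oconns_bin, List.mem_cons, List.mem_append, Ctx.mem_oconns_fill]
      tauto
    refine trueAt_iff_of_duplication (k := k) (i := i) (D := C.clusters) (E := [])
      (U := Φ.clusters ++ (k :: (A.clusters ++ B.clusters))) hQ ?_ ?_ (by simp) ?_ (by simp) hsplit
      hσ₁ hσ₂ ?_ ?_
    · refine Ctx.exists_oconn_fill fun o ho => ?_
      simp only [IForm.oconns_bin, List.mem_cons, List.mem_append, IForm.oconns_rename,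
        List.mem_map] at ho
      rcases ho with rfl | (rfl | ⟨o, ho, rfl⟩ | ho) | rfl | ⟨o, ho, rfl⟩ | ho
      · exact ⟨⟨c, k, i⟩, by simp, rfl, rfl⟩
      · exact ⟨⟨d, l, j⟩, by simp, rfl, rfl⟩
      · exact ⟨o, by simp [ho], rfl, rfl⟩
      · exact ⟨o, by simp [ho], rfl, rfl⟩
      · exact ⟨⟨d, l, j⟩, by simp, rfl, rfl⟩
      · exact ⟨o, by simp [ho], rfl, rfl⟩
      · exact ⟨o, by simp [ho], rfl, rfl⟩
    · refine perm_of_count fun x => ?_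
      simp only [Ctx.count_fill, IForm.clusters_bin, List.count_append, List.count_cons,
        List.count_nil]
      omega
    · refine perm_of_count fun x => ?_
      simp only [Ctx.count_fill, IForm.clusters_bin, List.count_append, List.count_cons,
        IForm.clusters_rename]
      omega
    · intro o ho hol
      rcases List.mem_cons.1 hol with hol | hol
      · exact hij.trans (hQ.cluster_ok ⟨d, l, j⟩ (hmem _ (by tauto)) o ho hol.symm).2.le
      · obtain ⟨o', ho', he⟩ := IForm.mem_clusters.1 hol
        exact (hC _ (IForm.mem_ranks.2 ⟨o', ho', rfl⟩)).trans
          (hQ.cluster_ok o' (hmem _ (by tauto)) o ho he).2.le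
    · intro f g τ hU hl hr h
      have hfix : ∀ o, (o ∈ Φ.oconns ∨ o = ⟨c, k, i⟩ ∨ o ∈ A.oconns ∨ o ∈ B.oconns) →
          g o.rank o.cluster = f o.rank o.cluster := by
        intro o ho
        rw [h o (hmem o (by tauto)), hU]
        simp only [List.mem_append, List.mem_cons, Ctx.mem_clusters]
        rcases ho with ho | rfl | ho | ho
        · exact .inl ⟨o, ho, rfl⟩
        · simp
        · simp [IForm.cluster_mem ho]
        · simp [IForm.cluster_mem ho]
      refine Ctx.metatrue_fill_congr (fun o ho => hfix o (by tauto)) ?_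
      have hk := hfix ⟨c, k, i⟩ (by tauto)
      have hgl := h ⟨d, l, j⟩ (hmem _ (by tauto))
      simp only at hk hgl
      simp only [IForm.Metatrue, hk, hgl]
      cases hf : f i k
      · rw [(hl hf).1]
        cases f j m
        · refine IForm.metatrue_rename fun o ho => ?_
          rw [h o (hmem o (by tauto)), (hl hf).2 _ (IForm.cluster_mem ho)]
        · exact IForm.metatrue_congr fun o ho => hfix o (by tauto)
      · rw [(hr hf).1]
        cases f j n
        · refine IForm.metatrue_rename fun o ho => ?_
          rw [h o (hmem o (by tauto)), (hr hf).2 _ (IForm.cluster_mem ho)]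
        · exact IForm.metatrue_congr fun o ho => hfix o (by tauto)
  | III Φ c d k i l m n j A B C D hP hQ' hsplit hij =>
    subst hP hQ'
    have hmem : ∀ o, o ∈ Φ.oconns ∨ o = ⟨d, l, j⟩ ∨ o = ⟨c, k, i⟩ ∨ o ∈ A.oconns ∨ o ∈ B.oconns ∨
        o ∈ C.oconns ∨ o ∈ D.oconns →
        o ∈ (Φ.fill (.bin d l j (.bin c k i A B) (.bin c k i C D))).oconns := by
      intro o
      simp only [IForm.oconns_bin, List.mem_cons, List.mem_append, Ctx.mem_oconns_fill]
      tauto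
    refine trueAt_iff_of_duplication (k := k) (i := i) (D := []) (E := [k]) (σ₁ := id) (σ₂ := id)
      (U := Φ.clusters ++ (k :: (A.clusters ++ B.clusters ++ (C.clusters ++ D.clusters))))
      hQ ?_ ?_ (by simp) ?_ (by simp) hsplit (by simp) (by simp) ?_ ?_
    · refine Ctx.exists_oconn_fill fun o ho => ?_
      simp only [IForm.oconns_bin, List.mem_cons, List.mem_append] at ho
      rcases ho with rfl | (rfl | ho | ho) | rfl | ho | ho
      · exact ⟨⟨c, k, i⟩, by simp, rfl, rfl⟩
      · exact ⟨⟨d, l, j⟩, by simp, rfl, rfl⟩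
      · exact ⟨o, by simp [ho], rfl, rfl⟩
      · exact ⟨o, by simp [ho], rfl, rfl⟩
      · exact ⟨⟨d, l, j⟩, by simp, rfl, rfl⟩
      · exact ⟨o, by simp [ho], rfl, rfl⟩
      · exact ⟨o, by simp [ho], rfl, rfl⟩
    · refine perm_of_count fun x => ?_
      simp only [Ctx.count_fill, IForm.clusters_bin, List.count_append, List.count_cons,
        List.count_nil]
      omega
    · refine perm_of_count fun x => ?_
      simp only [Ctx.count_fill, IForm.clusters_bin, List.count_append, List.count_cons,
        List.map_nil, List.count_nil]
      omega
    · intro o ho hol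
      simp only [List.mem_cons, List.not_mem_nil, or_false] at hol
      exact hij.trans (hQ.cluster_ok ⟨d, l, j⟩ (hmem _ (by tauto)) o ho hol.symm).2.le
    · intro f g τ hU hl hr h
      have hfix : ∀ o, (o ∈ Φ.oconns ∨ o = ⟨c, k, i⟩ ∨ o ∈ A.oconns ∨ o ∈ B.oconns ∨
          o ∈ C.oconns ∨ o ∈ D.oconns) → g o.rank o.cluster = f o.rank o.cluster := by
        intro o ho
        rw [h o (hmem o (by tauto)), hU]
        simp only [List.mem_append, List.mem_cons, Ctx.mem_clusters]
        rcases ho with ho | rfl | ho | ho | ho | ho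
        · exact .inl ⟨o, ho, rfl⟩
        · simp
        all_goals simp [IForm.cluster_mem ho]
      refine Ctx.metatrue_fill_congr (fun o ho => hfix o (by tauto)) ?_
      have hk := hfix ⟨c, k, i⟩ (by tauto)
      have hgl := h ⟨d, l, j⟩ (hmem _ (by tauto))
      simp only at hk hgl
      simp only [IForm.Metatrue, hk, hgl]
      cases hf : f i k
      · rw [(hl hf).1]
        cases f j m <;> exact IForm.metatrue_congr fun o ho => hfix o (by tauto)
      · rw [(hr hf).1]
        cases f j n <;> exact IForm.metatrue_congr fun o ho => hfix o (by tauto)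
  | IV Φ c k i l r j A B hP hQ' hA hB hlk hlΦ hr hij =>
    subst hP hQ'
    have hmem : ∀ o, o ∈ Φ.oconns ∨ o = ⟨c, k, i⟩ ∨ o ∈ A.oconns ∨ o ∈ B.oconns →
        o ∈ (Φ.fill (.bin c k i A B)).oconns := by
      intro o
      simp only [IForm.oconns_bin, List.mem_cons, List.mem_append, Ctx.mem_oconns_fill]
      tauto
    let τ : Side → ℕ+ → ℕ+ := fun s => match s with
      | .left => id
      | .right => Function.update id l r
    have hne : ∀ s, ∀ x ≠ l, τ s x = x := by
      rintro (_ | _) x hx <;> simp [τ, hx]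
    refine trueAt_iff_of_renaming (k := k) (i := i) (τ := τ) hQ ?_ ?_ ?_ ?_ ?_ ?_
    · refine Ctx.exists_oconn_fill fun o ho => ?_
      simp only [IForm.oconns_bin, List.mem_cons, List.mem_append, IForm.oconns_rename,
        List.mem_map] at ho
      rcases ho with rfl | ho | ⟨o, ho, rfl⟩
      · exact ⟨⟨c, k, i⟩, by simp, rfl, rfl⟩
      · exact ⟨o, by simp [ho], rfl, rfl⟩
      · exact ⟨o, by simp [ho], rfl, rfl⟩
    · exact fun s => hne s k hlk.symm
    · intro s o ho hoi
      refine hne s _ fun hol => ?_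
      obtain ⟨o', ho', hl', hj⟩ := hA
      have := (hQ.cluster_ok o' (hmem _ (by tauto)) o ho (hl'.trans hol.symm)).2
      exact absurd hoi (by rw [← this, hj]; exact hij.le.not_gt)
    · rintro (_ | _)
      · exact Set.injOn_id _
      · intro x hx y hy hxy
        by_cases hxl : x = l <;> by_cases hyl : y = l
        · rw [hxl, hyl]
        · subst hxl
          simp only [τ, Function.update_self, Function.update_of_ne hyl, id] at hxy
          exact absurd (hxy ▸ hy) hr
        · subst hyl
          simp only [τ, Function.update_self, Function.update_of_ne hxl, id] at hxy
          exact absurd (hxy ▸ hx) hr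
        · simpa only [hne .right x hxl, hne .right y hyl] using hxy
    · simp [Ctx.mem_clusters_fill]
    · intro f g h
      refine Ctx.metatrue_fill_congr (fun o ho => ?_) ?_
      · rw [h o (hmem o (by tauto)), hne]
        rintro rfl
        exact hlΦ (Ctx.mem_clusters.2 ⟨o, ho, rfl⟩)
      · have hk := h ⟨c, k, i⟩ (hmem _ (by tauto))
        simp only [hne _ k hlk.symm] at hk
        simp only [IForm.Metatrue, hk]
        cases hf : f i k
        · refine IForm.metatrue_congr fun o ho => ?_
          rw [h o (hmem o (by tauto)), hf]; rfl
        · refine IForm.metatrue_rename fun o ho => ?_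
          rw [h o (hmem o (by tauto)), hf]

/-! ### Classical cirquents -/

theorem quantified_of_strategy {conj : ℕ+ → Prop} {φ : (ℕ+ → ℕ+ → Side) → Prop}
    (F : ℕ+ → ℕ+ → Side) (L : List ℕ+) (hL : L.Nodup) : ∀ f₀ : ℕ+ → ℕ+ → Side,
      (∀ f, (∀ r ∈ L, ¬ conj r → f r = F r) → (∀ r ∉ L, f r = f₀ r) → φ f) →
      Quantified conj L φ f₀ := by
  induction L with
  | nil => exact fun f₀ h => h f₀ (by simp) (by simp)
  | cons i L ih =>
    intro f₀ h
    rw [List.nodup_cons] at hL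
    have key : ∀ a, (¬ conj i → a = F i) → Quantified conj L φ (Function.update f₀ i a) := by
      intro a ha
      refine ih hL.2 _ fun f h1 h2 => h f ?_ ?_
      · rintro r hr hc
        rcases List.mem_cons.1 hr with rfl | hr
        · rw [h2 r hL.1, Function.update_self, ha hc]
        · exact h1 r hr hc
      · intro r hr
        simp only [List.mem_cons, not_or] at hr
        rw [h2 r hr.2, Function.update_of_ne hr.1]
    simp only [Quantified]
    split_ifs with hc
    · exact fun a => key a fun h => absurd hc h
    · exact ⟨F i, key _ fun _ => rfl⟩

theorem not_quantified_of_strategy {conj : ℕ+ → Prop} {φ : (ℕ+ → ℕ+ → Side) → Prop}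
    (F : ℕ+ → ℕ+ → Side) (L : List ℕ+) (hL : L.Nodup) : ∀ f₀ : ℕ+ → ℕ+ → Side,
      (∀ f, (∀ r ∈ L, conj r → f r = F r) → (∀ r ∉ L, f r = f₀ r) → ¬ φ f) →
      ¬ Quantified conj L φ f₀ := by
  induction L with
  | nil => exact fun f₀ h => h f₀ (by simp) (by simp)
  | cons i L ih =>
    intro f₀ h
    rw [List.nodup_cons] at hL
    have key : ∀ a, (conj i → a = F i) → ¬ Quantified conj L φ (Function.update f₀ i a) := by
      intro a ha
      refine ih hL.2 _ fun f h1 h2 => h f ?_ ?_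
      · rintro r hr hc
        rcases List.mem_cons.1 hr with rfl | hr
        · rw [h2 r hL.1, Function.update_self, ha hc]
        · exact h1 r hr hc
      · intro r hr
        simp only [List.mem_cons, not_or] at hr
        rw [h2 r hr.2, Function.update_of_ne hr.1]
    simp only [Quantified]
    split_ifs with hc
    · exact fun H => key (F i) (fun _ => rfl) (H (F i))
    · rintro ⟨a, H⟩
      exact key a (fun h => absurd h hc) H

/-- If all clusters are singletons, one choice function is optimal for both quantifiers. -/
theorem exists_optimal_choice (v : α → Bool) (T : IForm α) (hT : T.clusters.Nodup) :
    ∃ h : ℕ+ → Side, ∀ f : ℕ+ → ℕ+ → Side,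
      ((∀ o ∈ T.oconns, o.conn = .disj → f o.rank o.cluster = h o.cluster) →
        T.toFormula.Holds v → T.Metatrue v f) ∧
      ((∀ o ∈ T.oconns, o.conn = .conj → f o.rank o.cluster = h o.cluster) →
        T.Metatrue v f → T.toFormula.Holds v) := by
  classical
  induction T with
  | lit L => exact ⟨fun _ => .left, fun f => ⟨fun _ h => h, fun _ h => h⟩⟩
  | bin c k i A B ihA ihB =>
    simp only [IForm.clusters_bin, List.nodup_cons, List.mem_append, not_or,
      List.nodup_append'] at hT
    obtain ⟨⟨hkA, hkB⟩, hA, hB, hAB⟩ := hT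
    obtain ⟨gA, hgA⟩ := ihA hA
    obtain ⟨gB, hgB⟩ := ihB hB
    let s : Side := match c with
      | .conj => if A.toFormula.Holds v then .right else .left
      | .disj => if A.toFormula.Holds v then .left else .right
    let g : ℕ+ → Side := fun x => if x = k then s else if x ∈ A.clusters then gA x else gB x
    have egA : ∀ o ∈ A.oconns, g o.cluster = gA o.cluster := by
      intro o ho
      have h1 := IForm.cluster_mem ho
      have h2 : o.cluster ≠ k := fun h => hkA (h ▸ h1)
      simp [g, h1, h2]
    have egB : ∀ o ∈ B.oconns, g o.cluster = gB o.cluster := by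
      intro o ho
      have h1 := IForm.cluster_mem ho
      have h2 : o.cluster ≠ k := fun h => hkB (h ▸ h1)
      have h3 : o.cluster ∉ A.clusters := fun h => hAB h h1
      simp [g, h2, h3]
    refine ⟨g, fun f => ⟨fun hf hh => ?_, fun hf hm => ?_⟩⟩ <;>
      simp only [IForm.oconns_bin, List.mem_cons, List.mem_append] at hf
    · have mA := (hgA f).1 fun o ho hc => (hf o (by tauto) hc).trans (egA o ho)
      have mB := (hgB f).1 fun o ho hc => (hf o (by tauto) hc).trans (egB o ho)
      cases c with
      | conj =>
        simp only [IForm.toFormula, Formula.Holds] at hh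
        simp only [IForm.Metatrue]
        cases f i k
        · exact mA hh.1
        · exact mB hh.2
      | disj =>
        have hk := hf _ (.inl rfl) rfl
        simp only [IForm.toFormula, Formula.Holds] at hh
        simp only [IForm.Metatrue, hk]
        by_cases h : A.toFormula.Holds v
        · simpa [g, s, h] using mA h
        · simpa [g, s, h] using mB (hh.resolve_left h)
    · have mA := (hgA f).2 fun o ho hc => (hf o (by tauto) hc).trans (egA o ho)
      have mB := (hgB f).2 fun o ho hc => (hf o (by tauto) hc).trans (egB o ho)
      cases c with
      | disj =>
        simp only [IForm.Metatrue] at hm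
        simp only [IForm.toFormula, Formula.Holds]
        cases hfk : f i k <;> rw [hfk] at hm
        · exact .inl (mA hm)
        · exact .inr (mB hm)
      | conj =>
        have hk := hf _ (.inl rfl) rfl
        simp only [IForm.toFormula, Formula.Holds]
        simp only [IForm.Metatrue, hk] at hm
        by_cases h : A.toFormula.Holds v
        · simp only [g, s, h, if_true] at hm
          exact ⟨h, mB hm⟩
        · simp only [g, s, h, if_true, if_false] at hm
          exact absurd (mA hm) h

theorem trueAt_iff_holds {T : IForm α} (hwf : T.Wf) (hT : T.clusters.Nodup) (v : α → Bool) :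
    T.TrueAt v ↔ T.toFormula.Holds v := by
  obtain ⟨h, hh⟩ := exists_optimal_choice v T hT
  constructor
  · intro ht
    by_contra hn
    refine not_quantified_of_strategy (fun _ => h) _ (Finset.sort_nodup _ _) _ ?_ ht
    intro f hf _ hm
    refine hn ((hh f).2 (fun o ho hc => ?_) hm)
    rw [hf o.rank (by simpa using IForm.mem_ranks.2 ⟨o, ho, rfl⟩) ⟨o, ho, rfl, hc⟩]
  · intro hH
    refine quantified_of_strategy (fun _ => h) _ (Finset.sort_nodup _ _) _ ?_
    intro f hf _
    refine (hh f).1 (fun o ho hc => ?_) hH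
    rw [hf o.rank (by simpa using IForm.mem_ranks.2 ⟨o, ho, rfl⟩)]
    rintro ⟨o', ho', hr, hc'⟩
    have := hwf.rank_ok o' ho' o ho hr
    rw [hc, hc'] at this
    cases this

theorem Cirquent.wf (C : Cirquent α) : C.tree.Wf := ⟨C.cluster_ok, C.rank_ok⟩

theorem Cirquent.isClassical_iff {C : Cirquent α} : C.IsClassical ↔ C.tree.clusters.Nodup := by
  rw [List.nodup_iff_count_eq_one]
  rfl

/-- The calculus is sound. -/
theorem Cirquent.Provable.valid {C : Cirquent α} (h : C.Provable) : C.Valid := by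
  obtain ⟨pf, ⟨A, hA, hAx⟩, hlast, hchain⟩ := h
  have hAv : A.Valid := fun v =>
    (trueAt_iff_holds A.wf (Cirquent.isClassical_iff.1 hAx.1) v).2 (hAx.2 v)
  clear hAx
  induction pf generalizing A with
  | nil => simp at hA
  | cons D pf ih =>
    obtain rfl : D = A := by simpa using hA
    cases pf with
    | nil =>
      obtain rfl : D = C := by simpa using hlast
      exact hAv
    | cons E pf =>
      rw [List.isChain_cons_cons] at hchain
      refine ih E rfl (by simpa using hlast) hchain.2 fun v => ?_
      exact (trueAt_iff_of_rule E.wf hchain.1).1 (hAv v)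

/-! ### Derivations inside a context -/

theorem IForm.Wf.of_rename {P Q : IForm α} (hQ : Q.Wf) (β : ℕ+ → ℕ+)
    (h : ∀ o ∈ P.oconns, o.rename β ∈ Q.oconns) : P.Wf where
  cluster_ok o ho o' ho' e :=
    hQ.cluster_ok (o.rename β) (h o ho) (o'.rename β) (h o' ho') (by simp [e])
  rank_ok o ho o' ho' e := hQ.rank_ok (o.rename β) (h o ho) (o'.rename β) (h o' ho') e

/-- A rule application between cirquents. -/
def Step (P Q : IForm α) : Prop := P.Wf ∧ Q.Wf ∧ Rule P Q

/-- `Q` can be derived from `P`. -/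
def Der : IForm α → IForm α → Prop := Relation.ReflTransGen Step

theorem Der.wf {P Q : IForm α} (h : Der P Q) (hQ : Q.Wf) : P.Wf := by
  rcases Relation.ReflTransGen.cases_head h with rfl | ⟨R, hR, -⟩
  exacts [hQ, hR.1]

theorem IForm.count_pos_of_mem {T : IForm α} {o : Oconn} (h : o ∈ T.oconns) :
    0 < T.clusters.count o.cluster :=
  List.count_pos_iff.2 (IForm.cluster_mem h)

/-- `S` is derived from `S'` in the context `Φ`, and every connective of `S'` is a copy of one of
`S` which is a singleton of the premise or a non-singleton shared with the conclusion. -/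
structure DerIn (Φ : Ctx α) (S' S : IForm α) : Prop where
  der : Der (Φ.fill S') (Φ.fill S)
  exists_oconn : ∀ o ∈ S'.oconns, ∃ o' ∈ S.oconns, o'.conn = o.conn ∧ o'.rank = o.rank
  singleton_or : ∀ o ∈ S'.oconns, (Φ.fill S').IsSingleton o.cluster ∨
    (o ∈ S.oconns ∧ ¬ (Φ.fill S).IsSingleton o.cluster)

namespace DerIn

theorem refl (Φ : Ctx α) (S : IForm α) : DerIn Φ S S where
  der := Relation.ReflTransGen.refl
  exists_oconn o ho := ⟨o, ho, rfl, rfl⟩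
  singleton_or o ho := by tauto

theorem trans {Φ : Ctx α} {R S T : IForm α} (h : DerIn Φ R S) (h' : DerIn Φ S T) :
    DerIn Φ R T where
  der := Relation.ReflTransGen.trans h.der h'.der
  exists_oconn o ho := by
    obtain ⟨o₁, h₁, hc, hr⟩ := h.exists_oconn o ho
    obtain ⟨o₂, h₂, hc', hr'⟩ := h'.exists_oconn o₁ h₁
    exact ⟨o₂, h₂, hc'.trans hc, hr'.trans hr⟩
  singleton_or o ho := by
    rcases h.singleton_or o ho with h1 | ⟨h1, h2⟩
    · exact .inl h1
    · exact .inr ((h'.singleton_or o h1).resolve_left h2)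

theorem wf {Φ : Ctx α} {S' S : IForm α} (h : DerIn Φ S' S) (hS : (Φ.fill S).Wf) :
    (Φ.fill S').Wf := h.der.wf hS

theorem le_rank {Φ : Ctx α} {S' S : IForm α} {i : ℕ+} (h : DerIn Φ S' S)
    (hS : ∀ o ∈ S.oconns, i ≤ o.rank) : ∀ o ∈ S'.oconns, i ≤ o.rank := by
  intro o ho
  obtain ⟨o', ho', -, hr⟩ := h.exists_oconn o ho
  exact hr ▸ hS o' ho'

theorem disjoint {Φ : Ctx α} {S' S : IForm α} (h : DerIn Φ S' S)
    (hS : ∀ x ∈ S.clusters, x ∉ Φ.clusters) : ∀ x ∈ S'.clusters, x ∉ Φ.clusters := by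
  intro x hx hxΦ
  obtain ⟨o, ho, rfl⟩ := IForm.mem_clusters.1 hx
  rcases h.singleton_or o ho with h1 | ⟨h1, -⟩
  · rw [IForm.IsSingleton, Ctx.count_fill] at h1
    have h2 := IForm.count_pos_of_mem ho
    have h3 := List.count_pos_iff.2 hxΦ
    omega
  · exact hS _ (IForm.cluster_mem h1) hxΦ

theorem binL {Φ : Ctx α} {c : Conn} {k i : ℕ+} {A' A B : IForm α}
    (h : DerIn (Φ.comp (.binL c k i .hole B)) A' A) :
    DerIn Φ (.bin c k i A' B) (.bin c k i A B) where
  der := by simpa [Ctx.fill] using h.der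
  exists_oconn o ho := by
    simp only [IForm.oconns_bin, List.mem_cons, List.mem_append] at ho ⊢
    rcases ho with rfl | ho | ho
    · exact ⟨_, .inl rfl, rfl, rfl⟩
    · obtain ⟨o', h', e⟩ := h.exists_oconn o ho
      exact ⟨o', .inr (.inl h'), e⟩
    · exact ⟨o, .inr (.inr ho), rfl, rfl⟩
  singleton_or o ho := by
    have hs := h.singleton_or
    simp only [Ctx.fill_comp, Ctx.fill] at hs
    simp only [IForm.oconns_bin, List.mem_cons, List.mem_append] at ho ⊢
    by_cases hoA : o ∈ A'.oconns
    · rcases hs o hoA with h1 | h1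
      exacts [.inl h1, .inr ⟨.inr (.inl h1.1), h1.2⟩]
    have ho' : o = ⟨c, k, i⟩ ∨ o ∈ B.oconns := by tauto
    by_cases hsing : (Φ.fill (.bin c k i A B)).IsSingleton o.cluster
    · left
      have hpos : 0 < (k :: B.clusters).count o.cluster := by
        rw [List.count_pos_iff, List.mem_cons]
        rcases ho' with rfl | h
        exacts [.inl rfl, .inr (IForm.cluster_mem h)]
      simp only [IForm.IsSingleton, Ctx.count_fill, IForm.clusters_bin, List.count_cons,
        List.count_append] at hsing hs hpos ⊢
      have hA : A.clusters.count o.cluster = 0 := by omega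
      have hA' : A'.clusters.count o.cluster = 0 := by
        rw [List.count_eq_zero]
        intro hmem
        obtain ⟨o₂, h₂, e⟩ := IForm.mem_clusters.1 hmem
        have hp := IForm.count_pos_of_mem h₂
        rcases hs o₂ h₂ with h3 | h3
        · rw [e] at h3 hp; omega
        · have := IForm.count_pos_of_mem h3.1
          rw [e] at this; omega
      omega
    · exact .inr ⟨by tauto, hsing⟩

theorem binR {Φ : Ctx α} {c : Conn} {k i : ℕ+} {A B' B : IForm α}
    (h : DerIn (Φ.comp (.binR c k i A .hole)) B' B) :
    DerIn Φ (.bin c k i A B') (.bin c k i A B) where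
  der := by simpa [Ctx.fill] using h.der
  exists_oconn o ho := by
    simp only [IForm.oconns_bin, List.mem_cons, List.mem_append] at ho ⊢
    rcases ho with rfl | ho | ho
    · exact ⟨_, .inl rfl, rfl, rfl⟩
    · exact ⟨o, .inr (.inl ho), rfl, rfl⟩
    · obtain ⟨o', h', e⟩ := h.exists_oconn o ho
      exact ⟨o', .inr (.inr h'), e⟩
  singleton_or o ho := by
    have hs := h.singleton_or
    simp only [Ctx.fill_comp, Ctx.fill] at hs
    simp only [IForm.oconns_bin, List.mem_cons, List.mem_append] at ho ⊢
    by_cases hoB : o ∈ B'.oconns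
    · rcases hs o hoB with h1 | h1
      exacts [.inl h1, .inr ⟨.inr (.inr h1.1), h1.2⟩]
    have ho' : o = ⟨c, k, i⟩ ∨ o ∈ A.oconns := by tauto
    by_cases hsing : (Φ.fill (.bin c k i A B)).IsSingleton o.cluster
    · left
      have hpos : 0 < (k :: A.clusters).count o.cluster := by
        rw [List.count_pos_iff, List.mem_cons]
        rcases ho' with rfl | h
        exacts [.inl rfl, .inr (IForm.cluster_mem h)]
      simp only [IForm.IsSingleton, Ctx.count_fill, IForm.clusters_bin, List.count_cons,
        List.count_append] at hsing hs hpos ⊢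
      have hB : B.clusters.count o.cluster = 0 := by omega
      have hB' : B'.clusters.count o.cluster = 0 := by
        rw [List.count_eq_zero]
        intro hmem
        obtain ⟨o₂, h₂, e⟩ := IForm.mem_clusters.1 hmem
        have hp := IForm.count_pos_of_mem h₂
        rcases hs o₂ h₂ with h3 | h3
        · rw [e] at h3 hp; omega
        · have := IForm.count_pos_of_mem h3.1
          rw [e] at this; omega
      omega
    · exact .inr ⟨by tauto, hsing⟩

end DerIn

/-! ### Duplication of singletons -/

/-- `ρ` renames the singletons of `Q` to fresh clusters and fixes the other clusters; `β` is a
left inverse of `ρ` that fixes the clusters of `Q`. -/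
structure Duplicator (Q : IForm α) (ρ β : ℕ+ → ℕ+) : Prop where
  left_inv : ∀ x ∈ Q.clusters, β (ρ x) = x
  fix : ∀ x ∈ Q.clusters, β x = x
  of_not_singleton : ∀ x, ¬ Q.IsSingleton x → ρ x = x
  fresh : ∀ x ∈ Q.clusters, Q.IsSingleton x → ρ x ∉ Q.clusters

theorem exists_duplicator (Q : IForm α) : ∃ ρ β, Duplicator Q ρ β := by
  classical
  obtain ⟨N, hN⟩ := Q.clusters.toFinset.exists_le
  simp only [List.mem_toFinset] at hN
  have hlt : ∀ x, N < x + N := fun x => by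
    rw [add_comm]; exact PNat.lt_add_right N x
  refine ⟨fun x => if Q.IsSingleton x then x + N else x, fun x => if x ≤ N then x else x - N,
    ?_, ?_, ?_, ?_⟩
  · intro x hx
    by_cases h : Q.IsSingleton x
    · simp only [h, if_true, (hlt x).not_ge, if_false]
      exact PNat.add_sub
    · simp [h, hN x hx]
  · intro x hx
    simp [hN x hx]
  · intro x hx
    simp [hx]
  · intro x hx h hmem
    simp only [h, if_true] at hmem
    exact (hlt x).not_ge (hN _ hmem)

theorem Duplicator.eq_of_mem {Q : IForm α} {ρ β : ℕ+ → ℕ+} (h : Duplicator Q ρ β) {x : ℕ+}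
    (hx : x ∈ Q.clusters) (hρ : ρ x ∈ Q.clusters) : ρ x = x := by
  by_contra hne
  refine h.fresh x hx ?_ hρ
  by_contra h'
  exact hne (h.of_not_singleton x h')

section

variable {Φ : Ctx α} {S S' : IForm α} {D E : List Oconn} {ρ β : ℕ+ → ℕ+}

theorem Duplicator.count_eq_zero {Q : IForm α} (hρ : Duplicator Q ρ β) {L : List ℕ+}
    (hL : ∀ x ∈ L, x ∈ Q.clusters) {y : ℕ+} (hy : y ∈ Q.clusters) (hy1 : Q.IsSingleton y) :
    (L.map ρ).count y = 0 := by
  rw [List.count_eq_zero, List.mem_map]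
  rintro ⟨x, hx, rfl⟩
  have := hρ.eq_of_mem (hL x hx) hy
  rw [this] at hy1
  exact hρ.fresh x (hL x hx) hy1 hy

theorem Duplicator.count_le {Q : IForm α} (hρ : Duplicator Q ρ β) {L : List ℕ+}
    (hL : ∀ x ∈ L, x ∈ Q.clusters) {x : ℕ+} (hx : x ∈ Q.clusters) :
    (L.map ρ).count (ρ x) ≤ L.count x := by
  have h1 := List.count_le_count_map (l := L.map ρ) (f := β) (x := ρ x)
  rw [List.map_map, hρ.left_inv x hx] at h1
  have h2 : L.map (β ∘ ρ) = L := by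
    conv_rhs => rw [← List.map_id L]
    exact List.map_congr_left fun x hx => hρ.left_inv x (hL x hx)
  rwa [h2] at h1

/-- Effect on well-formedness and singletons of replacing a part `S` by `S'` that contains an
additional copy of the connectives in `D` and omits those in `E`. -/
theorem duplicate (hwf : (Φ.fill S).Wf) (hρ : Duplicator (Φ.fill S) ρ β)
    (hperm : (S'.oconns ++ E).Perm (S.oconns ++ D.map (Oconn.rename ρ)))
    (hD : D.Subperm S.oconns) (hE : E ⊆ S.oconns) :
    (Φ.fill S').Wf ∧
    (Rule (Φ.fill S') (Φ.fill S) → DerIn Φ S' S) ∧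
    ∀ x ∈ D.map Oconn.cluster, x ∉ E.map Oconn.cluster → (Φ.fill S).IsSingleton x →
      (Φ.fill S').IsSingleton x ∧ (Φ.fill S').IsSingleton (ρ x) := by
  have hcount : ∀ y, S'.clusters.count y + (E.map Oconn.cluster).count y =
      S.clusters.count y + ((D.map Oconn.cluster).map ρ).count y := by
    intro y
    have := (hperm.map Oconn.cluster).count_eq y
    simpa [IForm.clusters, Function.comp_def] using this
  have hSQ : ∀ o ∈ S.oconns, o.cluster ∈ (Φ.fill S).clusters := fun o ho =>
    IForm.cluster_mem (Ctx.mem_oconns_fill.2 (.inr ho))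
  have hDQ : ∀ x ∈ D.map Oconn.cluster, x ∈ (Φ.fill S).clusters := by
    intro x hx
    obtain ⟨o, ho, rfl⟩ := List.mem_map.1 hx
    exact hSQ o (hD.subset ho)
  have hDcount : ∀ x, (D.map Oconn.cluster).count x ≤ S.clusters.count x := by
    intro x
    obtain ⟨D', hp, hs⟩ := hD
    rw [← (hp.map Oconn.cluster).count_eq]
    exact (hs.map Oconn.cluster).count_le x
  have hEcount : ∀ x ∈ D.map Oconn.cluster, (Φ.fill S).IsSingleton x →
      (E.map Oconn.cluster).count (ρ x) = 0 := by
    intro x hx h1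
    rw [List.count_eq_zero]
    intro hmem
    obtain ⟨o, ho, e⟩ := List.mem_map.1 hmem
    exact hρ.fresh x (hDQ x hx) h1 (e ▸ hSQ o (hE ho))
  have hρQ : ∀ x ∈ D.map Oconn.cluster, (Φ.fill S).IsSingleton x →
      Φ.clusters.count (ρ x) = 0 ∧ S.clusters.count (ρ x) = 0 := by
    intro x hx h1
    have := List.count_eq_zero.2 (hρ.fresh x (hDQ x hx) h1)
    rw [Ctx.count_fill] at this
    omega
  have hmem : ∀ o ∈ S'.oconns, o ∈ S.oconns ∨ ∃ o' ∈ D, o'.rename ρ = o := by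
    intro o ho
    have := (hperm.mem_iff (a := o)).1 (List.mem_append_left _ ho)
    rwa [List.mem_append, List.mem_map] at this
  have hwf' : (Φ.fill S').Wf := by
    refine hwf.of_rename β fun o ho => ?_
    have hfix : ∀ o ∈ (Φ.fill S).oconns, o.rename β = o := by
      rintro ⟨c, k, i⟩ ho
      simp [Oconn.rename, hρ.fix k (IForm.cluster_mem ho)]
    rcases Ctx.mem_oconns_fill.1 ho with ho | ho
    · have := Ctx.mem_oconns_fill (T := S).2 (.inl ho)
      rwa [hfix o this]
    · rcases hmem o ho with h | ⟨o', h, rfl⟩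
      · have := Ctx.mem_oconns_fill (Φ := Φ).2 (.inr h)
        rwa [hfix o this]
      · have := Ctx.mem_oconns_fill (Φ := Φ).2 (.inr (hD.subset h))
        have e : (o'.rename ρ).rename β = o' := by
          rcases o' with ⟨c, k, i⟩
          simp [Oconn.rename, hρ.left_inv k (IForm.cluster_mem this)]
        rwa [e]
  refine ⟨hwf', fun hrule => ⟨Relation.ReflTransGen.single ⟨hwf', hwf, hrule⟩, ?_, ?_⟩, ?_⟩
  · intro o ho
    rcases hmem o ho with h | ⟨o', h, rfl⟩
    · exact ⟨o, h, rfl, rfl⟩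
    · exact ⟨o', hD.subset h, rfl, rfl⟩
  · intro o ho
    have hpos := IForm.count_pos_of_mem ho
    have main : o ∈ S.oconns → (Φ.fill S').IsSingleton o.cluster ∨
        (o ∈ S.oconns ∧ ¬ (Φ.fill S).IsSingleton o.cluster) := by
      intro h
      by_cases h1 : (Φ.fill S).IsSingleton o.cluster
      · left
        have h2 := hcount o.cluster
        rw [hρ.count_eq_zero hDQ (hSQ o h) h1] at h2
        simp only [IForm.IsSingleton, Ctx.count_fill] at h1 ⊢
        omega
      · exact .inr ⟨h, h1⟩
    rcases hmem o ho with h | ⟨o', h, e⟩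
    · exact main h
    · have hoD : o'.cluster ∈ D.map Oconn.cluster := List.mem_map.2 ⟨o', h, rfl⟩
      by_cases h1 : (Φ.fill S).IsSingleton o'.cluster
      · left
        subst e
        rw [Oconn.rename_cluster] at hpos ⊢
        have h2 := hcount (ρ o'.cluster)
        have h3 := hρQ _ hoD h1
        have h4 := hρ.count_le hDQ (hDQ _ hoD)
        have h5 := hDcount o'.cluster
        simp only [IForm.IsSingleton, Ctx.count_fill] at h1 ⊢
        omega
      · have e' : o'.rename ρ = o' := by
          rcases o' with ⟨c, k, i⟩
          simp [Oconn.rename, hρ.of_not_singleton k h1]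
        exact main (by rw [← e, e']; exact hD.subset h)
  · intro x hoD hoE h1
    have h2 := hcount x
    rw [hρ.count_eq_zero hDQ (hDQ _ hoD) h1, List.count_eq_zero.2 hoE] at h2
    have h3 := hcount (ρ x)
    have h4 := hρQ _ hoD h1
    have h5 := hρ.count_le hDQ (hDQ _ hoD)
    have h6 := hDcount x
    have h7 : 0 < ((D.map Oconn.cluster).map ρ).count (ρ x) :=
      List.count_pos_iff.2 (List.mem_map.2 ⟨_, hoD, rfl⟩)
    have h8 := hEcount _ hoD h1
    simp only [IForm.IsSingleton, Ctx.count_fill] at h1 ⊢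
    omega

end

section

variable {Φ : Ctx α} {c d : Conn} {k i l j : ℕ+} {A B C D : IForm α}

open Classical in
theorem oconn_perm_of_count {L M : List Oconn} (h : ∀ x, L.count x = M.count x) : L.Perm M :=
  List.perm_iff_count.2 h

open Classical in
theorem derIn_II_left (hwf : (Φ.fill (.bin d l j (.bin c k i A B) C)).Wf) (hij : i ≤ j)
    (hC : ∀ o ∈ C.oconns, i ≤ o.rank) :
    ∃ ρ β, Duplicator (Φ.fill (.bin d l j (.bin c k i A B) C)) ρ β ∧
      DerIn Φ (.bin c k i (.bin d l j A C) (.bin d (ρ l) j B (C.rename ρ)))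
        (.bin d l j (.bin c k i A B) C) := by
  obtain ⟨ρ, β, hρ⟩ := exists_duplicator (Φ.fill (.bin d l j (.bin c k i A B) C))
  refine ⟨ρ, β, hρ, ?_⟩
  have hperm : ((.bin c k i (.bin d l j A C) (.bin d (ρ l) j B (C.rename ρ)) :
      IForm α).oconns ++ []).Perm
      ((.bin d l j (.bin c k i A B) C : IForm α).oconns ++
        ((⟨d, l, j⟩ : Oconn) :: C.oconns).map (Oconn.rename ρ)) := by
    refine oconn_perm_of_count fun x => ?_
    simp only [IForm.oconns_bin, IForm.oconns_rename, List.count_append, List.count_cons,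
      List.map_cons, List.count_nil, Oconn.rename]
    omega
  have hsub : ((⟨d, l, j⟩ : Oconn) :: C.oconns).Subperm
      (.bin d l j (.bin c k i A B) C : IForm α).oconns := by
    rw [List.subperm_ext_iff]
    intro x _
    simp only [IForm.oconns_bin, List.count_append, List.count_cons]
    omega
  obtain ⟨-, h2, h3⟩ := duplicate hwf hρ hperm hsub (by simp)
  simp only [List.map_cons, List.mem_cons, List.map_nil, List.not_mem_nil, not_false_eq_true,
    true_imp_iff, forall_eq_or_imp] at h3
  have h4 : ∀ s ∈ C.clusters, _ := h3.2
  refine h2 (.II_left Φ c d k i l l (ρ l) j A B C C (C.rename ρ) rfl rfl ⟨?_, h3.1⟩ hij ?_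
    ⟨id, (IForm.rename_eq_self fun _ _ => rfl).symm, ?_⟩ ⟨ρ, rfl, ?_⟩)
  · exact fun h => ⟨rfl, hρ.of_not_singleton l h⟩
  · intro t ht
    obtain ⟨o, ho, rfl⟩ := IForm.mem_ranks.1 ht
    exact hC o ho
  · exact fun s hs => ⟨fun h => (h4 s hs h).1, fun _ => rfl⟩
  · exact fun s hs => ⟨fun h => (h4 s hs h).2, hρ.of_not_singleton s⟩

open Classical in
theorem derIn_II_right (hwf : (Φ.fill (.bin d l j C (.bin c k i A B))).Wf) (hij : i ≤ j)
    (hC : ∀ o ∈ C.oconns, i ≤ o.rank) :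
    ∃ ρ β, Duplicator (Φ.fill (.bin d l j C (.bin c k i A B))) ρ β ∧
      DerIn Φ (.bin c k i (.bin d l j C A) (.bin d (ρ l) j (C.rename ρ) B))
        (.bin d l j C (.bin c k i A B)) := by
  obtain ⟨ρ, β, hρ⟩ := exists_duplicator (Φ.fill (.bin d l j C (.bin c k i A B)))
  refine ⟨ρ, β, hρ, ?_⟩
  have hperm : ((.bin c k i (.bin d l j C A) (.bin d (ρ l) j (C.rename ρ) B) :
      IForm α).oconns ++ []).Perm
      ((.bin d l j C (.bin c k i A B) : IForm α).oconns ++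
        ((⟨d, l, j⟩ : Oconn) :: C.oconns).map (Oconn.rename ρ)) := by
    refine oconn_perm_of_count fun x => ?_
    simp only [IForm.oconns_bin, IForm.oconns_rename, List.count_append, List.count_cons,
      List.map_cons, List.count_nil, Oconn.rename]
    omega
  have hsub : ((⟨d, l, j⟩ : Oconn) :: C.oconns).Subperm
      (.bin d l j C (.bin c k i A B) : IForm α).oconns := by
    rw [List.subperm_ext_iff]
    intro x _
    simp only [IForm.oconns_bin, List.count_append, List.count_cons]
    omega
  obtain ⟨-, h2, h3⟩ := duplicate hwf hρ hperm hsub (by simp)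
  simp only [List.map_cons, List.mem_cons, List.map_nil, List.not_mem_nil, not_false_eq_true,
    true_imp_iff, forall_eq_or_imp] at h3
  have h4 : ∀ s ∈ C.clusters, _ := h3.2
  refine h2 (.II_right Φ c d k i l l (ρ l) j A B C C (C.rename ρ) rfl rfl ⟨?_, h3.1⟩ hij ?_
    ⟨id, (IForm.rename_eq_self fun _ _ => rfl).symm, ?_⟩ ⟨ρ, rfl, ?_⟩)
  · exact fun h => ⟨rfl, hρ.of_not_singleton l h⟩
  · intro t ht
    obtain ⟨o, ho, rfl⟩ := IForm.mem_ranks.1 ht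
    exact hC o ho
  · exact fun s hs => ⟨fun h => (h4 s hs h).1, fun _ => rfl⟩
  · exact fun s hs => ⟨fun h => (h4 s hs h).2, hρ.of_not_singleton s⟩

open Classical in
theorem derIn_III (hwf : (Φ.fill (.bin d l j (.bin c k i A B) (.bin c k i C D))).Wf) (hij : i ≤ j)
    (hlk : l ≠ k) :
    ∃ ρ β, Duplicator (Φ.fill (.bin d l j (.bin c k i A B) (.bin c k i C D))) ρ β ∧
      DerIn Φ (.bin c k i (.bin d l j A C) (.bin d (ρ l) j B D))
        (.bin d l j (.bin c k i A B) (.bin c k i C D)) := by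
  obtain ⟨ρ, β, hρ⟩ := exists_duplicator (Φ.fill (.bin d l j (.bin c k i A B) (.bin c k i C D)))
  refine ⟨ρ, β, hρ, ?_⟩
  have hperm : ((.bin c k i (.bin d l j A C) (.bin d (ρ l) j B D) :
      IForm α).oconns ++ [(⟨c, k, i⟩ : Oconn)]).Perm
      ((.bin d l j (.bin c k i A B) (.bin c k i C D) : IForm α).oconns ++
        [(⟨d, l, j⟩ : Oconn)].map (Oconn.rename ρ)) := by
    refine oconn_perm_of_count fun x => ?_
    simp only [IForm.oconns_bin, List.count_append, List.count_cons,
      List.map_cons, List.map_nil, List.count_nil, Oconn.rename]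
    omega
  have hsub : [(⟨d, l, j⟩ : Oconn)].Subperm
      (.bin d l j (.bin c k i A B) (.bin c k i C D) : IForm α).oconns := by
    simp
  obtain ⟨-, h2, h3⟩ := duplicate hwf hρ hperm hsub (by simp)
  have h4 := h3 l (by simp) (by simpa using hlk)
  exact h2 (.III Φ c d k i l l (ρ l) j A B C D rfl rfl
    ⟨fun h => ⟨rfl, hρ.of_not_singleton l h⟩, h4⟩ hij)

open Classical in
theorem derIn_I_left (hwf : (Φ.fill (.bin c k i (.bin c k i A B) C)).Wf) :
    DerIn Φ (.bin c k i A C) (.bin c k i (.bin c k i A B) C) := by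
  obtain ⟨ρ, β, hρ⟩ := exists_duplicator (Φ.fill (.bin c k i (.bin c k i A B) C))
  refine (duplicate (D := []) (E := ⟨c, k, i⟩ :: B.oconns) hwf hρ ?_ (by simp) ?_).2.1
    (.I_left Φ .hole c k i A B C rfl rfl)
  · refine oconn_perm_of_count fun x => ?_
    simp only [IForm.oconns_bin, List.count_append, List.count_cons, List.map_nil, List.count_nil]
    omega
  · intro x
    simp only [IForm.oconns_bin, List.mem_append, List.mem_cons]
    tauto

open Classical in
theorem derIn_I_right (hwf : (Φ.fill (.bin c k i C (.bin c k i B A))).Wf) :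
    DerIn Φ (.bin c k i C A) (.bin c k i C (.bin c k i B A)) := by
  obtain ⟨ρ, β, hρ⟩ := exists_duplicator (Φ.fill (.bin c k i C (.bin c k i B A)))
  refine (duplicate (D := []) (E := ⟨c, k, i⟩ :: B.oconns) hwf hρ ?_ (by simp) ?_).2.1
    (.I_right Φ .hole c k i A B C rfl rfl)
  · refine oconn_perm_of_count fun x => ?_
    simp only [IForm.oconns_bin, List.count_append, List.count_cons, List.map_nil, List.count_nil]
    omega
  · intro x
    simp only [IForm.oconns_bin, List.mem_append, List.mem_cons]
    tauto

end

/-! ### Moving a cluster of least rank to the root -/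

theorem IForm.Wf.mem_of_cluster_mem {Q S : IForm α} (hQ : Q.Wf) (hS : S.oconns ⊆ Q.oconns)
    {o : Oconn} (ho : o ∈ Q.oconns) (h : o.cluster ∈ S.clusters) : o ∈ S.oconns := by
  obtain ⟨o', ho', e⟩ := IForm.mem_clusters.1 h
  have h1 := hQ.cluster_ok o' (hS ho') o ho e
  have : o' = o := by
    cases o; cases o'
    simp_all
  exact this ▸ ho'

theorem exists_derIn_root {c : Conn} {k i : ℕ+} (S : IForm α) : ∀ Φ : Ctx α, (Φ.fill S).Wf →
    ⟨c, k, i⟩ ∈ S.oconns → (∀ o ∈ S.oconns, i ≤ o.rank) →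
    ∃ A B, DerIn Φ (.bin c k i A B) S ∧ k ∉ A.clusters ∧ k ∉ B.clusters := by
  induction S with
  | lit L => intro Φ _ h; simp at h
  | bin d l j S T ihS ihT =>
    intro Φ hwf hk hi
    have hsub : ∀ {Φ : Ctx α} {d l j} {S T : IForm α}, S.oconns ⊆ (Φ.fill (.bin d l j S T)).oconns ∧
        T.oconns ⊆ (Φ.fill (.bin d l j S T)).oconns := by
      intro Φ d l j S T
      constructor <;> intro o ho <;> exact Ctx.mem_oconns_fill.2 (.inr (by simp [ho]))
    have hkQ : ⟨c, k, i⟩ ∈ (Φ.fill (.bin d l j S T)).oconns := Ctx.mem_oconns_fill.2 (.inr hk)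
    have hiS : ∀ o ∈ S.oconns, i ≤ o.rank := fun o ho => hi o (by simp [ho])
    have hiT : ∀ o ∈ T.oconns, i ≤ o.rank := fun o ho => hi o (by simp [ho])
    have hij : i ≤ j := hi ⟨d, l, j⟩ (by simp)
    have left : k ∈ S.clusters → ∃ A B, DerIn Φ (.bin d l j (.bin c k i A B) T) (.bin d l j S T) ∧
        k ∉ A.clusters ∧ k ∉ B.clusters := by
      intro hkS
      obtain ⟨A, B, h, hA, hB⟩ := ihS (Φ.comp (.binL d l j .hole T))
        (by simpa [Ctx.fill] using hwf) (hwf.mem_of_cluster_mem hsub.1 hkQ hkS) hiS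
      exact ⟨A, B, h.binL, hA, hB⟩
    have right : ∀ S', (Φ.fill (.bin d l j S' T)).Wf → k ∈ T.clusters →
        ∃ A B, DerIn Φ (.bin d l j S' (.bin c k i A B)) (.bin d l j S' T) ∧
        k ∉ A.clusters ∧ k ∉ B.clusters := by
      intro S' hwf' hkT
      obtain ⟨A, B, h, hA, hB⟩ := ihT (Φ.comp (.binR d l j S' .hole))
        (by simpa [Ctx.fill] using hwf') (hwf.mem_of_cluster_mem hsub.2 hkQ hkT) hiT
      exact ⟨A, B, h.binR, hA, hB⟩
    by_cases hlk : l = k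
    · subst hlk
      obtain ⟨rfl, rfl⟩ := hwf.cluster_ok ⟨d, l, j⟩ (Ctx.mem_oconns_fill.2 (.inr (by simp)))
        ⟨c, l, i⟩ hkQ rfl
      obtain ⟨A, hA, hlA⟩ : ∃ A, DerIn Φ (.bin d l j A T) (.bin d l j S T) ∧ l ∉ A.clusters := by
        by_cases hS : l ∈ S.clusters
        · obtain ⟨A, B, h, hA, -⟩ := left hS
          exact ⟨A, (derIn_I_left (h.wf hwf)).trans h, hA⟩
        · exact ⟨S, .refl _ _, hS⟩
      have hwfA := hA.wf hwf
      obtain ⟨B, hB, hlB⟩ : ∃ B, DerIn Φ (.bin d l j A B) (.bin d l j A T) ∧ l ∉ B.clusters := by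
        by_cases hT : l ∈ T.clusters
        · obtain ⟨B, B', h, -, hB'⟩ := right A hwfA hT
          exact ⟨B', (derIn_I_right (h.wf hwfA)).trans h, hB'⟩
        · exact ⟨T, .refl _ _, hT⟩
      exact ⟨A, B, hB.trans hA, hlA, hlB⟩
    · have fresh : ∀ {ρ β : ℕ+ → ℕ+} {Q : IForm α}, Duplicator Q ρ β → k ∈ Q.clusters →
          (l ∈ Q.clusters → k ≠ ρ l) ∧
          ∀ C : IForm α, C.clusters ⊆ Q.clusters → k ∉ C.clusters → k ∉ (C.rename ρ).clusters := by
        intro ρ β Q hρ hkQ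
        have : ∀ x ∈ Q.clusters, k = ρ x → x = k := fun x hx e => by
          rw [e]; exact (hρ.eq_of_mem hx (e ▸ hkQ)).symm
        refine ⟨fun hl e => hlk (this l hl e), fun C hC hkC => ?_⟩
        rw [IForm.clusters_rename, List.mem_map]
        rintro ⟨x, hx, e⟩
        exact hkC (this x (hC hx) e.symm ▸ hx)
      by_cases hS : k ∈ S.clusters
      · obtain ⟨A, B, hAB, hA, hB⟩ := left hS
        have hwf' := hAB.wf hwf
        by_cases hT : k ∈ T.clusters
        · obtain ⟨C, D, hCD, hC, hD⟩ := right _ hwf' hT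
          obtain ⟨ρ, β, hρ, h⟩ := derIn_III (hCD.wf hwf') hij hlk
          have hf := (fresh hρ (by simp [Ctx.mem_clusters_fill])).1
            (by simp [Ctx.mem_clusters_fill])
          exact ⟨_, _, h.trans (hCD.trans hAB), by simp [hA, hC, Ne.symm hlk],
            by simp [hB, hD, hf]⟩
        · obtain ⟨ρ, β, hρ, h⟩ := derIn_II_left hwf' hij hiT
          obtain ⟨hf, hf'⟩ := fresh hρ (by simp [Ctx.mem_clusters_fill])
          have hf := hf (by simp [Ctx.mem_clusters_fill])
          have hf' := hf' T (fun x hx => by simp [Ctx.mem_clusters_fill, hx]) hT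
          exact ⟨_, _, h.trans hAB, by simp [hA, hT, Ne.symm hlk],
            by rw [IForm.clusters_bin]; simp only [List.mem_cons, List.mem_append]; tauto⟩
      · have hT : k ∈ T.clusters := by
          have := IForm.cluster_mem hk
          simp only [IForm.clusters_bin, List.mem_cons, List.mem_append] at this
          tauto
        obtain ⟨A, B, hAB, hA, hB⟩ := right S hwf hT
        obtain ⟨ρ, β, hρ, h⟩ := derIn_II_right (hAB.wf hwf) hij hiS
        obtain ⟨hf, hf'⟩ := fresh hρ (by simp [Ctx.mem_clusters_fill])
        have hf := hf (by simp [Ctx.mem_clusters_fill])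
        have hf' := hf' S (fun x hx => by simp [Ctx.mem_clusters_fill, hx]) hS
        exact ⟨_, _, h.trans hAB, by simp [hA, hS, Ne.symm hlk],
          by rw [IForm.clusters_bin]; simp only [List.mem_cons, List.mem_append]; tauto⟩

theorem exists_derIn_singletons {Φ : Ctx α} {i : ℕ+} (K : Finset ℕ+) : ∀ T : IForm α,
    (Φ.fill T).Wf → (∀ o ∈ T.oconns, i ≤ o.rank) → (∀ x ∈ T.clusters, x ∉ Φ.clusters) →
    (∀ o ∈ T.oconns, o.rank = i → (Φ.fill T).IsSingleton o.cluster ∨ o.cluster ∈ K) →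
    ∃ T', DerIn Φ T' T ∧ ∀ o ∈ T'.oconns, o.rank = i → (Φ.fill T').IsSingleton o.cluster := by
  induction K using Finset.induction_on with
  | empty =>
    intro T _ _ _ h
    exact ⟨T, .refl _ _, fun o ho hi => (h o ho hi).resolve_right (by simp)⟩
  | insert k K _ ih =>
    intro T hwf hi hdisj hK
    by_cases hk : ∃ o ∈ T.oconns, o.rank = i ∧ o.cluster = k
    · obtain ⟨⟨c, k, i⟩, hk, rfl, rfl⟩ := hk
      obtain ⟨A, B, h, hA, hB⟩ := exists_derIn_root T Φ hwf hk hi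
      have hK' : ∀ o ∈ (IForm.bin c k i A B).oconns, o.rank = i →
          (Φ.fill (.bin c k i A B)).IsSingleton o.cluster ∨ o.cluster ∈ K := by
        intro o ho hoi
        rcases h.singleton_or o ho with h1 | ⟨h1, h2⟩
        · exact .inl h1
        · have := (hK o h1 hoi).resolve_left h2
          rcases Finset.mem_insert.1 this with e | e
          · left
            have h3 := hdisj _ (IForm.cluster_mem hk)
            simp only at e h3
            simp only [e, IForm.IsSingleton, Ctx.count_fill, IForm.clusters_bin,
              List.count_cons_self, List.count_append, List.count_eq_zero.2 h3,
              List.count_eq_zero.2 hA, List.count_eq_zero.2 hB]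
          · exact .inr e
      obtain ⟨T', h', hT'⟩ := ih _ (h.wf hwf) (h.le_rank hi) (h.disjoint hdisj) hK'
      exact ⟨T', h'.trans h, hT'⟩
    · refine ih T hwf hi hdisj fun o ho hoi => ?_
      rcases hK o ho hoi with h1 | h1
      · exact .inl h1
      · rcases Finset.mem_insert.1 h1 with e | e
        · exact absurd ⟨o, ho, hoi, e⟩ hk
        · exact .inr e

/-! ### Separating the least rank from the others -/

/-- The connectives of rank `i` form the top of the formula, and all others have greater rank. -/
inductive IForm.Top (i : ℕ+) : IForm α → Prop where
  | leaf {T : IForm α} (h : ∀ o ∈ T.oconns, i < o.rank) : IForm.Top i T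
  | node {c : Conn} {k : ℕ+} {A B : IForm α} (hA : IForm.Top i A) (hB : IForm.Top i B) :
      IForm.Top i (.bin c k i A B)

theorem IForm.Top.le_rank {i : ℕ+} {T : IForm α} (h : T.Top i) : ∀ o ∈ T.oconns, i ≤ o.rank := by
  induction h with
  | leaf h => exact fun o ho => (h o ho).le
  | node _ _ ihA ihB =>
    intro o ho
    simp only [IForm.oconns_bin, List.mem_cons, List.mem_append] at ho
    rcases ho with rfl | ho | ho
    exacts [le_rfl, ihA o ho, ihB o ho]

theorem exists_top_of_right {i j : ℕ+} (hij : i < j) {d : Conn} {B : IForm α} (hB : B.Top i) :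
    ∀ (Φ : Ctx α) (l : ℕ+) (A : IForm α), (∀ o ∈ A.oconns, i < o.rank) →
      (Φ.fill (.bin d l j A B)).Wf → ∃ T, T.Top i ∧ DerIn Φ T (.bin d l j A B) := by
  induction hB with
  | leaf hB =>
    intro Φ l A hA _
    refine ⟨_, .leaf ?_, .refl _ _⟩
    intro o ho
    simp only [IForm.oconns_bin, List.mem_cons, List.mem_append] at ho
    rcases ho with rfl | ho | ho
    exacts [hij, hA o ho, hB o ho]
  | @node c k B₁ B₂ hB₁ hB₂ ih₁ ih₂ =>
    intro Φ l A hA hwf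
    obtain ⟨ρ, β, -, h⟩ := derIn_II_right hwf hij.le fun o ho => (hA o ho).le
    have hwf₁ := h.wf hwf
    obtain ⟨T₁, hT₁, h₁⟩ := ih₁ (Φ.comp (.binL c k i .hole _)) l A hA
      (by simpa [Ctx.fill] using hwf₁)
    have hwf₂ := h₁.binL.wf hwf₁
    obtain ⟨T₂, hT₂, h₂⟩ := ih₂ (Φ.comp (.binR c k i T₁ .hole)) (ρ l) (A.rename ρ)
      (by
        intro o ho
        rw [IForm.oconns_rename, List.mem_map] at ho
        obtain ⟨o, ho, rfl⟩ := ho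
        exact hA o ho) (by simpa [Ctx.fill] using hwf₂)
    exact ⟨_, .node hT₁ hT₂, h₂.binR.trans (h₁.binL.trans h)⟩

theorem exists_top_of_bin {i j : ℕ+} (hij : i < j) {d : Conn} {A : IForm α} (hA : A.Top i) :
    ∀ (Φ : Ctx α) (l : ℕ+) (B : IForm α), B.Top i →
      (Φ.fill (.bin d l j A B)).Wf → ∃ T, T.Top i ∧ DerIn Φ T (.bin d l j A B) := by
  induction hA with
  | leaf hA => exact fun Φ l B hB hwf => exists_top_of_right hij hB Φ l _ hA hwf
  | @node c k A₁ A₂ hA₁ hA₂ ih₁ ih₂ =>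
    intro Φ l B hB hwf
    obtain ⟨ρ, β, -, h⟩ := derIn_II_left hwf hij.le hB.le_rank
    have hwf₁ := h.wf hwf
    obtain ⟨T₁, hT₁, h₁⟩ := ih₁ (Φ.comp (.binL c k i .hole _)) l B hB
      (by simpa [Ctx.fill] using hwf₁)
    have hwf₂ := h₁.binL.wf hwf₁
    obtain ⟨T₂, hT₂, h₂⟩ := ih₂ (Φ.comp (.binR c k i T₁ .hole)) (ρ l) (B.rename ρ)
      (by
        clear * - hB
        induction hB with
        | leaf h =>
          refine .leaf fun o ho => ?_
          rw [IForm.oconns_rename, List.mem_map] at ho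
          obtain ⟨o, ho, rfl⟩ := ho
          exact h o ho
        | node _ _ ihA ihB => exact .node ihA ihB) (by simpa [Ctx.fill] using hwf₂)
    exact ⟨_, .node hT₁ hT₂, h₂.binR.trans (h₁.binL.trans h)⟩

theorem exists_top {i : ℕ+} (S : IForm α) : ∀ Φ : Ctx α, (Φ.fill S).Wf →
    (∀ o ∈ S.oconns, i ≤ o.rank) → ∃ T, T.Top i ∧ DerIn Φ T S := by
  induction S with
  | lit L => exact fun Φ _ _ => ⟨.lit L, .leaf (by simp), .refl _ _⟩
  | bin d l j A B ihA ihB =>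
    intro Φ hwf hi
    obtain ⟨A', hA', h₁⟩ := ihA (Φ.comp (.binL d l j .hole B)) (by simpa [Ctx.fill] using hwf)
      fun o ho => hi o (by simp [ho])
    have hwf₁ := h₁.binL.wf hwf
    obtain ⟨B', hB', h₂⟩ := ihB (Φ.comp (.binR d l j A' .hole)) (by simpa [Ctx.fill] using hwf₁)
      fun o ho => hi o (by simp [ho])
    have h₃ := h₂.binR.trans h₁.binL
    rcases (hi ⟨d, l, j⟩ (by simp)).eq_or_lt with e | hij
    · simp only at e
      subst e
      exact ⟨_, .node hA' hB', h₃⟩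
    · obtain ⟨T, hT, h⟩ := exists_top_of_bin hij hA' Φ l B' hB' (h₃.wf hwf)
      exact ⟨T, hT, h.trans h₃⟩

/-! ### Reduction to classical cirquents -/

theorem Ctx.fill_bin_left (Φ : Ctx α) (c : Conn) (k i : ℕ+) (A B : IForm α) :
    (Φ.comp (.binL c k i .hole B)).fill A = Φ.fill (.bin c k i A B) := by
  simp [Ctx.fill]

theorem Ctx.fill_bin_right (Φ : Ctx α) (c : Conn) (k i : ℕ+) (A B : IForm α) :
    (Φ.comp (.binR c k i A .hole)).fill B = Φ.fill (.bin c k i A B) := by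
  simp [Ctx.fill]

/-- Rule IV makes a cluster of `A` and `B` disjoint. -/
theorem exists_step_separate {Φ : Ctx α} {c : Conn} {k i x r : ℕ+} {A B : IForm α}
    (hwf : (Φ.fill (.bin c k i A B)).Wf) (hxA : x ∈ A.clusters) (hxB : x ∈ B.clusters)
    (hk : k ∉ A.clusters) (hx : x ∉ Φ.clusters) (hi : ∀ o ∈ B.oconns, o.cluster = x → i < o.rank)
    (hr : r ∉ (Φ.fill (.bin c k i A B)).clusters) :
    Step (Φ.fill (.bin c k i A (B.rename (Function.update id x r)))) (Φ.fill (.bin c k i A B)) := by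
  have hmem : ∀ o, o ∈ Φ.oconns ∨ o = ⟨c, k, i⟩ ∨ o ∈ A.oconns ∨ o ∈ B.oconns →
      o ∈ (Φ.fill (.bin c k i A B)).oconns := by
    intro o
    simp only [IForm.oconns_bin, List.mem_cons, List.mem_append, Ctx.mem_oconns_fill]
    tauto
  obtain ⟨oA, hoA, eA⟩ := IForm.mem_clusters.1 hxA
  obtain ⟨oB, hoB, eB⟩ := IForm.mem_clusters.1 hxB
  refine ⟨hwf.of_rename (Function.update id r x) ?_, hwf,
    .IV Φ c k i x r oB.rank A B rfl rfl ⟨oA, hoA, eA, ?_⟩ ⟨oB, hoB, eB, rfl⟩ ?_ hx hr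
      (hi oB hoB eB)⟩
  · have hfix : ∀ o ∈ (Φ.fill (.bin c k i A B)).oconns,
        o.rename (Function.update id r x) = o := by
      rintro ⟨d, l, j⟩ ho
      have : l ≠ r := fun e => hr (e ▸ IForm.cluster_mem ho)
      simp [Oconn.rename, this]
    have hfix' : ∀ o ∈ B.oconns,
        (o.rename (Function.update id x r)).rename (Function.update id r x) = o := by
      rintro ⟨d, l, j⟩ ho
      have : l ≠ r := fun e => hr (e ▸ IForm.cluster_mem (hmem _ (.inr (.inr (.inr ho)))))
      by_cases hl : l = x <;> simp [Oconn.rename, hl, this]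
    intro o ho
    simp only [Ctx.mem_oconns_fill, IForm.oconns_bin, IForm.oconns_rename, List.mem_cons,
      List.mem_append, List.mem_map] at ho
    rcases ho with ho | ho | ho | ⟨o, ho, rfl⟩
    · rw [hfix o (hmem o (by tauto))]; exact hmem o (by tauto)
    · rw [hfix o (hmem o (by tauto))]; exact hmem o (by tauto)
    · rw [hfix o (hmem o (by tauto))]; exact hmem o (by tauto)
    · rw [hfix' o ho]; exact hmem o (by tauto)
  · exact (hwf.cluster_ok oA (hmem _ (by tauto)) oB (hmem _ (by tauto)) (eA.trans eB.symm)).2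
  · rintro rfl; exact hk hxA

theorem exists_separate {Φ : Ctx α} {c : Conn} {k i : ℕ+} {A : IForm α} (hkA : k ∉ A.clusters)
    (hAΦ : ∀ x ∈ A.clusters, x ∉ Φ.clusters) (K : Finset ℕ+) : ∀ B : IForm α,
    (Φ.fill (.bin c k i A B)).Wf → (∀ x ∈ A.clusters, x ∈ B.clusters → x ∈ K) →
    k ∉ B.clusters → (∀ x ∈ B.clusters, x ∉ Φ.clusters) → (∀ o ∈ B.oconns, i ≤ o.rank) →
    (∀ o ∈ B.oconns, o.rank = i → B.IsSingleton o.cluster ∧ o.cluster ∉ A.clusters) →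
    ∃ ρ : ℕ+ → ℕ+, Der (Φ.fill (.bin c k i A (B.rename ρ))) (Φ.fill (.bin c k i A B)) ∧
      (∀ x ∈ (B.rename ρ).clusters, x ∉ A.clusters ∧ x ∉ Φ.clusters ∧ x ≠ k) ∧
      ∀ o ∈ (B.rename ρ).oconns, o.rank = i → (B.rename ρ).IsSingleton o.cluster := by
  induction K using Finset.induction_on with
  | empty =>
    intro B hwf hK hkB hBΦ hi hs
    refine ⟨id, ?_, ?_⟩ <;> rw [IForm.rename_eq_self (σ := id) fun _ _ => rfl]
    · exact Relation.ReflTransGen.refl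
    · refine ⟨fun x hx => ⟨fun h => ?_, hBΦ x hx, fun h => hkB (h ▸ hx)⟩,
        fun o ho h => (hs o ho h).1⟩
      simpa using hK x h hx
  | insert x K _ ih =>
    intro B hwf hK hkB hBΦ hi hs
    by_cases hx : x ∈ A.clusters ∧ x ∈ B.clusters
    · obtain ⟨hxA, hxB⟩ := hx
      obtain ⟨r, hr⟩ := Infinite.exists_notMem_finset (Φ.fill (.bin c k i A B)).clusters.toFinset
      rw [List.mem_toFinset] at hr
      have hir : ∀ o ∈ B.oconns, o.cluster = x → i < o.rank := by
        intro o ho e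
        refine (hi o ho).lt_of_ne fun h => (hs o ho h.symm).2 (e ▸ hxA)
      have hstep := exists_step_separate hwf hxA hxB hkA (hAΦ x hxA) hir hr
      simp only [Ctx.mem_clusters_fill, IForm.clusters_bin, List.mem_cons, List.mem_append,
        not_or] at hr
      obtain ⟨hrΦ, hrk, hrA, hrB⟩ := hr
      have hswap : B.rename (Function.update id x r) = B.rename (Equiv.swap x r) := by
        refine IForm.rename_congr fun y hy => ?_
        have hyr : y ≠ r := fun e => hrB (e ▸ hy)
        by_cases hyx : y = x
        · simp [hyx]
        · simp [hyx, Equiv.swap_apply_of_ne_of_ne hyx hyr]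
      rw [hswap] at hstep
      have hval : ∀ y ∈ (B.rename (Equiv.swap x r)).clusters, y = r ∨ (y ∈ B.clusters ∧ y ≠ x) := by
        intro y hy
        rw [IForm.clusters_rename, List.mem_map] at hy
        obtain ⟨z, hz, rfl⟩ := hy
        by_cases hzx : z = x
        · left; simp [hzx]
        · right
          have hzr : z ≠ r := fun e => hrB (e ▸ hz)
          rw [Equiv.swap_apply_of_ne_of_ne hzx hzr]
          exact ⟨hz, hzx⟩
      obtain ⟨ρ, h1, h2⟩ := ih (B.rename (Equiv.swap x r)) hstep.1
        (by
          intro y hyA hyB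
          rcases hval y hyB with rfl | ⟨hy, hyx⟩
          · exact absurd hyA hrA
          · exact Finset.mem_of_mem_insert_of_ne (hK y hyA hy) hyx)
        (by
          intro h
          rcases hval k h with e | ⟨h, -⟩
          exacts [hrk e.symm, hkB h])
        (by
          intro y hy
          rcases hval y hy with rfl | ⟨hy, -⟩
          exacts [hrΦ, hBΦ y hy])
        (by
          intro o ho
          rw [IForm.oconns_rename, List.mem_map] at ho
          obtain ⟨o, ho, rfl⟩ := ho
          exact hi o ho)
        (by
          intro o ho hoi
          rw [IForm.oconns_rename, List.mem_map] at ho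
          obtain ⟨o, ho, rfl⟩ := ho
          obtain ⟨h1, h2⟩ := hs o ho hoi
          have hox : o.cluster ≠ x := fun e => h2 (e ▸ hxA)
          have hor : o.cluster ≠ r := fun e => hrB (e ▸ IForm.cluster_mem ho)
          constructor
          · rw [IForm.IsSingleton, IForm.clusters_rename, Oconn.rename_cluster,
              List.count_map_of_injective _ _ (Equiv.injective _)]
            exact h1
          · rw [Oconn.rename_cluster, Equiv.swap_apply_of_ne_of_ne hox hor]
            exact h2)
      refine ⟨ρ ∘ Equiv.swap x r, ?_⟩
      rw [← IForm.rename_rename]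
      exact ⟨h1.tail hstep, h2⟩
    · refine ih B hwf (fun y hyA hyB => ?_) hkB hBΦ hi hs
      refine Finset.mem_of_mem_insert_of_ne (hK y hyA hyB) ?_
      rintro rfl
      exact hx ⟨hyA, hyB⟩

/-- Any formula with ranks in `R` can be made classical inside a context with other clusters. -/
def Reducible (α : Type*) (R : Finset ℕ+) : Prop :=
  ∀ (T : IForm α) (Φ : Ctx α), (Φ.fill T).Wf → (∀ o ∈ T.oconns, o.rank ∈ R) →
    (∀ x ∈ T.clusters, x ∉ Φ.clusters) →
    ∃ T', Der (Φ.fill T') (Φ.fill T) ∧ (∀ x ∈ T'.clusters, x ∉ Φ.clusters) ∧ T'.clusters.Nodup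

theorem Reducible.of_top {R : Finset ℕ+} {i : ℕ+} (hR : Reducible α (R.erase i)) {T : IForm α}
    (hT : T.Top i) : ∀ (ρ : ℕ+ → ℕ+) (Φ : Ctx α), (Φ.fill (T.rename ρ)).Wf →
      (∀ o ∈ T.oconns, o.rank ∈ R) → (∀ x ∈ (T.rename ρ).clusters, x ∉ Φ.clusters) →
      (∀ o ∈ (T.rename ρ).oconns, o.rank = i → (T.rename ρ).IsSingleton o.cluster) →
      ∃ T', Der (Φ.fill T') (Φ.fill (T.rename ρ)) ∧ (∀ x ∈ T'.clusters, x ∉ Φ.clusters) ∧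
        T'.clusters.Nodup := by
  induction hT with
  | @leaf T h =>
    intro ρ Φ hwf hTR hdisj _
    refine hR _ Φ hwf (fun o ho => ?_) hdisj
    rw [IForm.oconns_rename, List.mem_map] at ho
    obtain ⟨o, ho, rfl⟩ := ho
    exact Finset.mem_erase.2 ⟨(h o ho).ne', hTR o ho⟩
  | @node c k A B hA hB ihA ihB =>
    intro ρ Φ hwf hTR hdisj hs
    have hAR : ∀ o ∈ A.oconns, o.rank ∈ R := fun o ho => hTR o (by simp [ho])
    have hBR : ∀ o ∈ B.oconns, o.rank ∈ R := fun o ho => hTR o (by simp [ho])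
    have hBi : ∀ o ∈ (B.rename ρ).oconns, i ≤ o.rank := by
      intro o ho
      rw [IForm.oconns_rename, List.mem_map] at ho
      obtain ⟨o, ho, rfl⟩ := ho
      exact hB.le_rank o ho
    simp only [IForm.rename] at hwf hdisj hs ⊢
    have hk := hs ⟨c, ρ k, i⟩ (by simp) rfl
    simp only [IForm.IsSingleton, IForm.clusters_bin, List.count_cons_self, List.count_append] at hk
    have hkA : ρ k ∉ (A.rename ρ).clusters := List.count_eq_zero.1 (by omega)
    have hkB : ρ k ∉ (B.rename ρ).clusters := List.count_eq_zero.1 (by omega)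
    have hkΦ : ρ k ∉ Φ.clusters := hdisj _ (by simp)
    have hAΦ : ∀ x ∈ (A.rename ρ).clusters, x ∉ Φ.clusters := fun x hx =>
      hdisj x (by rw [IForm.clusters_bin]; simp only [List.mem_cons, List.mem_append]; tauto)
    have hBΦ : ∀ x ∈ (B.rename ρ).clusters, x ∉ Φ.clusters := fun x hx =>
      hdisj x (by rw [IForm.clusters_bin]; simp only [List.mem_cons, List.mem_append]; tauto)
    have hsA : ∀ o ∈ (A.rename ρ).oconns, o.rank = i → (A.rename ρ).IsSingleton o.cluster := by
      intro o ho hoi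
      have h1 := hs o
        (by rw [IForm.oconns_bin]; simp only [List.mem_cons, List.mem_append]; tauto) hoi
      have h2 := IForm.count_pos_of_mem ho
      simp only [IForm.IsSingleton, IForm.clusters_bin, List.count_cons, List.count_append] at h1 ⊢
      omega
    have hsB : ∀ o ∈ (B.rename ρ).oconns, o.rank = i →
        (B.rename ρ).IsSingleton o.cluster ∧ o.cluster ∉ (A.rename ρ).clusters := by
      intro o ho hoi
      have h1 := hs o
        (by rw [IForm.oconns_bin]; simp only [List.mem_cons, List.mem_append]; tauto) hoi
      have h2 := IForm.count_pos_of_mem ho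
      rw [← List.count_eq_zero]
      simp only [IForm.IsSingleton, IForm.clusters_bin, List.count_cons, List.count_append] at h1 ⊢
      omega
    obtain ⟨σ, hder, hBσ, hsσ⟩ := exists_separate hkA hAΦ (A.rename ρ).clusters.toFinset
      (B.rename ρ) hwf (fun x hx _ => by simpa using hx) hkB hBΦ hBi hsB
    rw [IForm.rename_rename] at hder hBσ hsσ
    have hwf₁ := hder.wf hwf
    obtain ⟨A', hA', hA'Φ, hA'n⟩ := ihA ρ (Φ.comp (.binL c (ρ k) i .hole (B.rename (σ ∘ ρ))))
      (by rwa [Ctx.fill_bin_left]) hAR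
      (by
        intro x hx
        simp only [Ctx.mem_clusters_comp, Ctx.clusters, List.mem_cons, List.mem_append,
          List.not_mem_nil, false_or, not_or]
        exact ⟨hAΦ x hx, fun e => hkA (e ▸ hx), fun h => (hBσ x h).1 hx⟩) hsA
    rw [Ctx.fill_bin_left, Ctx.fill_bin_left] at hA'
    simp only [Ctx.mem_clusters_comp, Ctx.clusters, List.mem_cons, List.mem_append,
      List.not_mem_nil, false_or, not_or] at hA'Φ
    have hwf₂ := hA'.wf hwf₁
    obtain ⟨B', hB', hB'Φ, hB'n⟩ := ihB (σ ∘ ρ) (Φ.comp (.binR c (ρ k) i A' .hole))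
      (by rwa [Ctx.fill_bin_right]) hBR
      (by
        intro x hx
        simp only [Ctx.mem_clusters_comp, Ctx.clusters, List.mem_cons, List.mem_append,
          List.not_mem_nil, or_false, not_or]
        exact ⟨(hBσ x hx).2.1, (hBσ x hx).2.2, fun h => (hA'Φ x h).2.2 hx⟩) hsσ
    rw [Ctx.fill_bin_right, Ctx.fill_bin_right] at hB'
    simp only [Ctx.mem_clusters_comp, Ctx.clusters, List.mem_cons, List.mem_append,
      List.not_mem_nil, or_false, not_or] at hB'Φ
    refine ⟨.bin c (ρ k) i A' B',
      Relation.ReflTransGen.trans hB' (Relation.ReflTransGen.trans hA' hder), ?_, ?_⟩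
    · intro x hx
      simp only [IForm.clusters_bin, List.mem_cons, List.mem_append] at hx
      rcases hx with rfl | hx | hx
      exacts [hkΦ, (hA'Φ x hx).1, (hB'Φ x hx).1]
    · simp only [IForm.clusters_bin, List.nodup_cons, List.mem_append, not_or, List.nodup_append']
      exact ⟨⟨fun h => (hA'Φ _ h).2.1 rfl, fun h => (hB'Φ _ h).2.1 rfl⟩, hA'n, hB'n,
        fun x hxA hxB => (hB'Φ x hxB).2.2 hxA⟩

theorem reducible (R : Finset ℕ+) : Reducible α R := by
  induction R using Finset.strongInduction with
  | H R ih =>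
    intro T Φ hwf hTR hdisj
    by_cases hne : T.ranks.Nonempty
    · obtain ⟨i, hi, hmin⟩ := T.ranks.exists_min_image id hne
      have hle : ∀ o ∈ T.oconns, i ≤ o.rank := fun o ho =>
        hmin o.rank (IForm.mem_ranks.2 ⟨o, ho, rfl⟩)
      have hiR : i ∈ R := by
        obtain ⟨o, ho, rfl⟩ := IForm.mem_ranks.1 hi
        exact hTR o ho
      obtain ⟨T₁, h₁, hs₁⟩ := exists_derIn_singletons T.clusters.toFinset T hwf hle hdisj
        fun o ho _ => .inr (by simpa using IForm.cluster_mem ho)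
      have hwf₁ := h₁.wf hwf
      obtain ⟨T₂, htop, h₂⟩ := exists_top T₁ Φ hwf₁ (h₁.le_rank hle)
      have h := h₂.trans h₁
      have hdisj₂ := h.disjoint hdisj
      have hid : T₂.rename id = T₂ := IForm.rename_eq_self fun _ _ => rfl
      obtain ⟨T', hT', hT'Φ, hn⟩ := Reducible.of_top (ih _ (Finset.erase_ssubset hiR)) htop id Φ
        (by rw [hid]; exact h.wf hwf)
        (by
          intro o ho
          obtain ⟨o', ho', -, e⟩ := h.exists_oconn o ho
          exact e ▸ hTR o' ho')
        (by rwa [hid])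
        (by
          rw [hid]
          intro o ho hoi
          have hs : (Φ.fill T₂).IsSingleton o.cluster := by
            rcases h₂.singleton_or o ho with h3 | ⟨h3, h4⟩
            exacts [h3, absurd (hs₁ o h3 hoi) h4]
          rw [IForm.IsSingleton, Ctx.count_fill] at hs
          have := IForm.count_pos_of_mem ho
          rw [IForm.IsSingleton]
          omega)
      rw [hid] at hT'
      exact ⟨T', Relation.ReflTransGen.trans hT' h.der, hT'Φ, hn⟩
    · refine ⟨T, Relation.ReflTransGen.refl, hdisj, ?_⟩
      have hnil : T.oconns = [] := by
        rw [List.eq_nil_iff_forall_not_mem]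
        exact fun o ho => hne ⟨o.rank, IForm.mem_ranks.2 ⟨o, ho, rfl⟩⟩
      simp [IForm.clusters, hnil]

/-! ### Completeness -/

theorem Der.trueAt_iff {P Q : IForm α} (h : Der P Q) (v : α → Bool) : P.TrueAt v ↔ Q.TrueAt v := by
  induction h with
  | refl => rfl
  | tail _ hs ih => exact ih.trans (trueAt_iff_of_rule hs.2.1 hs.2.2)

theorem Der.provable {P Q : IForm α} (h : Der P Q) (hP : P.Wf)
    (hPp : (⟨P, hP.1, hP.2⟩ : Cirquent α).Provable) (hQ : Q.Wf) :
    (⟨Q, hQ.1, hQ.2⟩ : Cirquent α).Provable := by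
  induction h with
  | refl => exact hPp
  | @tail R Q _ hs ih =>
    obtain ⟨pf, ⟨A, hA, hAx⟩, hlast, hchain⟩ := ih hs.1
    refine ⟨pf ++ [⟨Q, hQ.1, hQ.2⟩], ⟨A, ?_, hAx⟩, by simp, ?_⟩
    · rw [List.head?_append, hA]; rfl
    · refine hchain.append (List.isChain_singleton _) ?_
      intro D hD E hE
      rw [hlast] at hD
      simp only [Option.mem_def, Option.some.injEq, List.head?_cons] at hD hE
      subst hD hE
      exact hs.2.2

/-- The calculus is complete. -/
theorem Cirquent.Valid.provable {C : Cirquent α} (h : C.Valid) : C.Provable := by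
  obtain ⟨T, hder, -, hn⟩ := reducible C.tree.ranks C.tree .hole C.wf
    (fun o ho => IForm.mem_ranks.2 ⟨o, ho, rfl⟩) (by simp [Ctx.clusters])
  have hder : Der T C.tree := hder
  have hT := hder.wf C.wf
  refine hder.provable hT ⟨[⟨T, hT.1, hT.2⟩], ⟨_, rfl, ?_, ?_⟩, rfl, List.isChain_singleton _⟩ C.wf
  · exact Cirquent.isClassical_iff.2 hn
  · exact fun v => (trueAt_iff_holds hT hn v).1 ((hder.trueAt_iff v).2 (h v))

end RIF

theorem theorem3p3 {α : Type*} (C : RIF.Cirquent α) :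
    C.Valid ↔ C.Provable :=
  ⟨RIF.Cirquent.Valid.provable, RIF.Cirquent.Provable.valid⟩
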